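/- Let $\Sigma\subset\mathbb R^d$ be an embedded $C^2$ hypersurface, possibly with boundary and not necessarily compact, with surface measure $d\sigma$ (the $(d-1)$-dimensional Hausdorff measure on $\Sigma$, normalised to agree with Lebesgue measure on $\mathbb{R}^{d-1}$). Assume that some connected component of $\Sigma$ is not contained in a hyperplane (if $\Sigma$ is connected, this says that $\Sigma$ is not contained in a hyperplane). Then there is a constant $c>0$, depending only on $\Sigma$ (and $d$), such that for every $R\ge 1$ there exist a function $f\in L^2(\Sigma;d\sigma)$ with $f\neq 0$, and a nonzero Schwartz function $h:\mathbb R^d\to\mathbb C$ whose Fourier transform $\hat h(x)=\int_{\mathbb R^d} h(\xi)e^{-2\pi i x\cdot \xi}\,d\xi$ is supported in the open ball $B_R=\{x\in\mathbb{R}^d:|x|<R\}$, such that the convolution $$(h*f\,d\sigma)(x)=\int_\Sigma h(x-y)f(y)\,d\sigma(y)$$ converges absolutely for every $x\in\mathbb R^d$ and defines an $L^2(\mathbb R^d)$ function, and $$\|h*f\,d\sigma\|_{L^2(\mathbb R^d)}^2\;\ge\; c\,\log R\;\|f\|_{L^2(\Sigma;d\sigma)}^2\int_{\mathbb R}\Big(\int_{\nu^\perp}|h(\lambda\nu+\omega)|\,d\omega\Big)^2d\lambda\qquad\text{for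 every }\nu\in\mathbb S^{d-1}.$$ Writing $P_\nu h(\lambda)(\omega)=h(\lambda\nu+\omega)$ for $\lambda\in\mathbb R$ and $\omega\in\nu^\perp$, the last integral is $\|P_\nu h\|_{L^2(L^1(\nu^\perp))}^2$. -/

import Mathlib

open MeasureTheory Set
open scoped ENNReal FourierTransform SchwartzMap RealInnerProductSpace

noncomputable section

/-- `S` is an (embedded) `C²` hypersurface of `ℝ^d`, possibly with boundary: around each of its
points there is a `C²` diffeomorphism `φ` between open sets of `ℝ^d` that carries `S` to a piece of
a hyperplane `{y | ⟪a, y⟫ = 0}` (slice chart at an interior point) or to a piece of a closed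
half-hyperplane `{y | ⟪a, y⟫ = 0, 0 ≤ ⟪b, y⟫}` (boundary slice chart).
Neither compactness nor closedness in `ℝ^d` is required. -/
def IsC2Hypersurface {d : ℕ} (S : Set (EuclideanSpace ℝ (Fin d))) : Prop :=
  ∀ p ∈ S, ∃ φ : OpenPartialHomeomorph (EuclideanSpace ℝ (Fin d)) (EuclideanSpace ℝ (Fin d)),
    p ∈ φ.source ∧ ContDiffOn ℝ 2 φ φ.source ∧ ContDiffOn ℝ 2 φ.symm φ.target ∧
      ((∃ a : EuclideanSpace ℝ (Fin d), a ≠ 0 ∧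
          ∀ x ∈ φ.source, x ∈ S ↔ ⟪a, φ x⟫ = 0) ∨
        (∃ a b : EuclideanSpace ℝ (Fin d), LinearIndependent ℝ ![a, b] ∧
          ∀ x ∈ φ.source, x ∈ S ↔ ⟪a, φ x⟫ = 0 ∧ 0 ≤ ⟪b, φ x⟫))

/-- The set `A` is contained in some affine hyperplane of `ℝ^d`. -/
def LiesInHyperplane {d : ℕ} (A : Set (EuclideanSpace ℝ (Fin d))) : Prop :=
  ∃ (a : EuclideanSpace ℝ (Fin d)) (t : ℝ), a ≠ 0 ∧ ∀ x ∈ A, ⟪a, x⟫ = t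

/-- The surface measure `dσ` of a hypersurface `S ⊆ ℝ^d`: the `(d-1)`-dimensional Hausdorff
measure, normalised to agree with Lebesgue measure on `ℝ^(d-1)`, restricted to `S`. -/
def surfaceMeasure {d : ℕ} (S : Set (EuclideanSpace ℝ (Fin d))) :
    Measure (EuclideanSpace ℝ (Fin d)) :=
  (Measure.euclideanHausdorffMeasure (d - 1)).restrict S

/-- The convolution `h * (f dσ)` of a function `h` with the complex measure `f dσ`. -/
def convMeasure {d : ℕ} (σ : Measure (EuclideanSpace ℝ (Fin d)))
    (h f : EuclideanSpace ℝ (Fin d) → ℂ) (x : EuclideanSpace ℝ (Fin d)) : ℂ :=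
  ∫ y, h (x - y) * f y ∂σ

/-- The restriction map `P_ν h (l) (ω) = h (l ν + ω)`, for `l ∈ ℝ` and `ω ∈ ν^⊥`. -/
def planeRestrict {d : ℕ} (ν : EuclideanSpace ℝ (Fin d)) (h : EuclideanSpace ℝ (Fin d) → ℂ)
    (l : ℝ) (ω : (Submodule.span ℝ {ν})ᗮ) : ℂ :=
  h (l • ν + (ω : EuclideanSpace ℝ (Fin d)))

/-- The mixed norm squared `‖P_ν h‖²_{L²(L¹(ν^⊥))} = ∫_ℝ (∫_{ν^⊥} |h (l ν + ω)| dω)² dl`. -/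
def mixedNormSq {d : ℕ} (ν : EuclideanSpace ℝ (Fin d)) (h : EuclideanSpace ℝ (Fin d) → ℂ) :
    ℝ≥0∞ :=
  ∫⁻ l : ℝ, (∫⁻ ω : (Submodule.span ℝ {ν})ᗮ, ‖planeRestrict ν h l ω‖ₑ) ^ 2

end

/-! Take `N` points `p + u i` of the surface that approach `p` geometrically. Let `f` be the
indicator of the union of `ρ`-balls around them, and let `h` be the sum, over all subsets `P` of the
indices, of a nonnegative band-limited bump of width `ρ` centred at `∑ i ∈ P, u i`. For each `i ∈
P`, the bump of `P.erase i` and the ball at `p + u i` both feed the convolution near `p + ∑ i ∈ P, u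
i`, so it is at least a multiple of `|P| ρ^(d-1)` there (`card_mul_le_enorm_convMeasure`). As `|P|`
is typically `N/2`, the left side is at least of order `2^N N² ρ^(3d-2)`, while `‖f‖²` is at most of
order `N ρ^(d-1)`.

If for every `ν` the projections `⟪ν, ∑ i ∈ P, u i⟫` overlap boundedly at scale `ρ`, the mixed norm
is at most of order `2^N ρ^(2d-1)` (`exists_mixedNormSq_le`). The powers of `ρ` cancel and a factor
`N` remains. Here `ρ` is comparable to `1/R` and is geometric in `N`, so `N` is of order `log R`.

Bounded overlap has to hold in all directions at once. It does when the coordinates of `u i` in some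
basis decay like powers of `q ^ i` with distinct exponents: every linear functional is then
dominated by a single coordinate, except at boundedly many `i`, and subset sums of a lacunary
sequence are separated (`exists_exceptional_subset_sums_separated`). Curvature provides such points:
tangential coordinates can be given orders `m, …, 2m-1` with `m = d - 1`, and the second fundamental
form forces order `2m` in the normal one (`exists_curve_of_second_fundamental_form_ne_zero`). A
surface with no curved point has a locally constant tangent hyperplane, hence flat components
(`IsC2Hypersurface.exists_isCurvedAt`). -/

/-! ### Band-limited bumps and their dilates and translates. -/

section Kernel

variable {V : Type*} [NormedAddCommGroup V] [InnerProductSpace ℝ V] [FiniteDimensional ℝ V]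
  [MeasurableSpace V] [BorelSpace V]

open scoped Convolution in
/-- A nonnegative band-limited Schwartz function that is bounded below near the origin. -/
theorem exists_nonneg_bandlimited_schwartz {κ : ℝ} (hκ : 0 < κ) :
    ∃ (H : 𝓢(V, ℂ)) (g : V → ℝ) (c : ℝ), 0 < c ∧ (∀ x, H x = (g x : ℂ)) ∧ (∀ x, 0 ≤ g x) ∧
      (∀ x, ‖x‖ ≤ 2 → c ≤ g x) ∧ ∀ ξ, κ ≤ ‖ξ‖ → 𝓕 (H : V → ℂ) ξ = 0 := by
  -- The bound `κ / 2` keeps the self-convolution of `b` inside the `κ`-ball; the bound `1 / 12`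
  -- makes `2π|⟪v, x⟫| ≤ π / 3` for `‖x‖ ≤ 2`, so that the cosine below is at least `1 / 2`.
  set δ : ℝ := min (κ / 2) (1 / 12) with hδ
  have hδ0 : 0 < δ := by positivity
  let b : ContDiffBump (0 : V) := ⟨δ / 2, δ, by positivity, by linarith⟩
  have hbs : ∀ x : V, δ ≤ ‖x‖ → b x = 0 := fun x hx =>
    b.zero_of_le_dist (by simpa [b] using hx)
  let φ : 𝓢(V, ℂ) := HasCompactSupport.toSchwartzMap (f := fun x => ((b x : ℝ) : ℂ))
    (b.hasCompactSupport.comp_left (g := fun t : ℝ => (t : ℂ)) (by simp))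
    (Complex.ofRealCLM.contDiff.comp b.contDiff)
  have hφ : ∀ x, φ x = ((b x : ℝ) : ℂ) := fun x => rfl
  let B := ContinuousLinearMap.mul ℂ ℂ
  let K := SchwartzMap.convolution B φ φ
  -- The bump is even, so averaging its transform with the reflected integral leaves a real cosine
  -- integral.
  have hFφ : ∀ x, 𝓕 φ x = ((∫ v, Real.cos (2 * Real.pi * ⟪v, x⟫) * b v : ℝ) : ℂ) := by
    intro x
    rw [SchwartzMap.fourier_coe]
    have hint : Integrable (fun v => Real.fourierChar (-⟪v, x⟫) • φ v) :=
      (Real.fourierIntegral_convergent_iff x).2 φ.integrable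
    have h1 : 𝓕 (φ : V → ℂ) x = ∫ v, Real.fourierChar (-⟪v, x⟫) • φ v := Real.fourier_eq _ _
    have h2 : 𝓕 (φ : V → ℂ) x = ∫ v, Real.fourierChar (⟪v, x⟫) • φ v := by
      rw [h1, ← integral_neg_eq_self]
      congr 1; ext v
      simp [hφ, b.neg]
    have hint2 : Integrable (fun v => Real.fourierChar (⟪v, x⟫) • φ v) := by
      have := hint.comp_neg
      refine this.congr (Filter.Eventually.of_forall fun v => ?_)
      simp [hφ, b.neg]
    have h3 : 2 * 𝓕 (φ : V → ℂ) x
        = ∫ v, (2 : ℂ) * ((Real.cos (2 * Real.pi * ⟪v, x⟫) * b v : ℝ) : ℂ) := by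
      rw [two_mul]
      nth_rewrite 1 [h1]
      rw [h2, ← integral_add hint hint2]
      congr 1; ext v
      simp only [hφ, Circle.smul_def, Real.fourierChar_apply, smul_eq_mul]
      push_cast
      rw [← add_mul, ← mul_assoc, Complex.two_cos]
      congr 1
      rw [add_comm]
      congr 2
      ring
    rw [integral_const_mul, integral_complex_ofReal] at h3
    exact mul_left_cancel₀ two_ne_zero h3
  have hbint : Integrable (fun v : V => b v) := b.continuous.integrable_of_hasCompactSupport
    b.hasCompactSupport
  have hbpos : 0 < ∫ v, b v := b.integral_pos
  -- The transform of `b * b` is the square of a real function, hence nonnegative.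
  refine ⟨𝓕 K, fun x => (∫ v, Real.cos (2 * Real.pi * ⟪v, x⟫) * b v) ^ 2,
    ((∫ v, b v) / 2) ^ 2, by positivity, ?_, fun x => sq_nonneg _, ?_, ?_⟩
  · intro x
    have : 𝓕 K = SchwartzMap.pairing B (𝓕 φ) (𝓕 φ) := SchwartzMap.fourier_convolution B φ φ
    rw [this]
    simp only [SchwartzMap.pairing_apply_apply, B, ContinuousLinearMap.mul_apply', hFφ x]
    push_cast; ring
  · intro x hx
    apply pow_le_pow_left₀ (by positivity)
    rw [div_eq_inv_mul, ← integral_const_mul]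
    apply integral_mono (hbint.const_mul _)
    · apply Continuous.integrable_of_hasCompactSupport
      · exact (by fun_prop : Continuous fun v : V => Real.cos (2 * Real.pi * ⟪v, x⟫)).mul
          b.continuous
      · exact b.hasCompactSupport.mul_left
    · intro v
      by_cases hv : δ ≤ ‖v‖
      · simp [hbs v hv]
      · apply mul_le_mul_of_nonneg_right _ b.nonneg
        have h1 : |⟪v, x⟫| ≤ 1 / 6 := by
          refine (abs_real_inner_le_norm v x).trans ?_
          have : ‖v‖ ≤ 1 / 12 := (not_le.1 hv).le.trans (min_le_right _ _)
          nlinarith [norm_nonneg v, norm_nonneg x]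
        have h2 : (2 : ℝ)⁻¹ = Real.cos (Real.pi / 3) := by rw [Real.cos_pi_div_three]; norm_num
        rw [h2, ← Real.cos_abs (2 * Real.pi * _)]
        have := Real.pi_pos
        apply Real.cos_le_cos_of_nonneg_of_le_pi (abs_nonneg _) (by linarith)
        rw [abs_mul, abs_of_pos (by positivity)]
        nlinarith
  · intro ξ hξ
    -- Transforming twice gives `K (-ξ)`, so the band limit is the support of `K`.
    have h1 : 𝓕⁻ ((𝓕 K : 𝓢(V, ℂ)) : V → ℂ) (-ξ) = K (-ξ) := by
      rw [← SchwartzMap.fourierInv_coe, FourierTransform.fourierInv_fourier_eq]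
    rw [Real.fourierInv_eq_fourier_neg, neg_neg] at h1
    rw [h1, SchwartzMap.convolution_apply, convolution_def]
    apply integral_eq_zero_of_ae
    refine Filter.Eventually.of_forall fun t => ?_
    simp only [hφ, B, ContinuousLinearMap.mul_apply', Pi.zero_apply]
    by_cases ht : δ ≤ ‖t‖
    · simp [hbs t ht]
    · have : δ ≤ ‖-ξ - t‖ := by
        have h3 : ‖-ξ‖ ≤ ‖-ξ - t‖ + ‖t‖ := norm_le_norm_sub_add _ _
        have h4 : δ ≤ κ / 2 := min_le_left _ _
        rw [norm_neg] at h3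
        push Not at ht
        linarith
      simp [hbs _ this]

/-- Translation only modulates the transform and dilation rescales the frequency, so zeros of the
transform are merely rescaled. -/
theorem fourier_comp_dilate_translate (F : V → ℂ) {ρ : ℝ} (hρ : 0 < ρ) (q ξ : V)
    (hF : 𝓕 F (ρ • ξ) = 0) : 𝓕 (fun x => F (ρ⁻¹ • (x - q))) ξ = 0 := by
  rw [Real.fourier_eq]
  rw [← integral_add_right_eq_self _ q]
  have : ∀ v : V, Real.fourierChar (-⟪v + q, ξ⟫) • F (ρ⁻¹ • (v + q - q)) =
      (Real.fourierChar (-⟪q, ξ⟫) : ℂ) *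
        (fun w => Real.fourierChar (-⟪w, ρ • ξ⟫) • F w) (ρ⁻¹ • v) := by
    intro v
    rw [← smul_eq_mul, ← Circle.smul_def]
    simp only [add_sub_cancel_right, smul_smul, ← AddChar.map_add_eq_mul, inner_add_left,
      inner_smul_left, inner_smul_right]
    congr 3
    simp
    field_simp
  simp_rw [this]
  rw [integral_const_mul]
  have h := Measure.integral_comp_inv_smul (volume : Measure V)
    (fun w => Real.fourierChar (-⟪w, ρ • ξ⟫) • F w) ρ
  rw [← Real.fourier_eq, hF] at h
  rw [h]
  simp

/-- Superpositions of translates of a fixed dilate of a Schwartz function. -/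
theorem exists_schwartz_sum_translates {ι : Type*} (H : 𝓢(V, ℂ)) {ρ : ℝ} (hρ : 0 < ρ)
    (s : Finset ι) (q : ι → V) :
    ∃ h : 𝓢(V, ℂ), (∀ x, h x = ∑ a ∈ s, H (ρ⁻¹ • (x - q a))) ∧
      ∀ ξ, 𝓕 (H : V → ℂ) (ρ • ξ) = 0 → 𝓕 (h : V → ℂ) ξ = 0 := by
  let T : ι → 𝓢(V, ℂ) := fun a =>
    (SchwartzMap.compCLMOfContinuousLinearEquiv ℂ
      (ContinuousLinearEquiv.smulLeft (Units.mk0 ρ⁻¹ (inv_ne_zero hρ.ne')) : V ≃L[ℝ] V) H).compSubConstCLM ℂ (q a)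
  have hT : ∀ a x, T a x = H (ρ⁻¹ • (x - q a)) := fun a x => rfl
  refine ⟨∑ a ∈ s, T a, ?_, ?_⟩
  · intro x
    simp [hT]
  · intro ξ hξ
    rw [← SchwartzMap.fourier_coe]
    have : 𝓕 (∑ a ∈ s, T a) = ∑ a ∈ s, 𝓕 (T a) :=
      map_sum (FourierTransform.fourierCLM ℂ 𝓢(V, ℂ)) T s
    rw [this, sum_apply]
    apply Finset.sum_eq_zero
    intro a _
    rw [SchwartzMap.fourier_coe]
    exact fourier_comp_dilate_translate (H : V → ℂ) hρ (q a) ξ hξ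

end Kernel

/-! ### Upper bound for the mixed norm. -/

theorem lintegral_comp_inv_smul_sub {W : Type*} [NormedAddCommGroup W] [NormedSpace ℝ W]
    [FiniteDimensional ℝ W] [MeasurableSpace W] [BorelSpace W] (μ : Measure W) [μ.IsAddHaarMeasure]
    (F : W → ℝ≥0∞) {ρ : ℝ} (hρ : 0 < ρ) (w : W) :
    ∫⁻ x, F (ρ⁻¹ • (x - w)) ∂μ = ENNReal.ofReal (ρ ^ Module.finrank ℝ W) * ∫⁻ x, F x ∂μ := by
  rw [lintegral_sub_right_eq_self (fun x => F (ρ⁻¹ • x)) w]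
  have h := lintegral_map_equiv (μ := μ) F
    (Homeomorph.smulOfNeZero (α := W) ρ⁻¹ (inv_ne_zero hρ.ne')).toMeasurableEquiv
  have h2 : Measure.map (fun x : W => ρ⁻¹ • x) μ = _ :=
    Measure.map_addHaar_smul μ (inv_ne_zero hρ.ne')
  change ∫⁻ x, F x ∂(Measure.map (fun x : W => ρ⁻¹ • x) μ) = ∫⁻ x, F (ρ⁻¹ • x) ∂μ at h
  rw [← h, h2, lintegral_smul_measure, smul_eq_mul]
  congr 2
  rw [inv_pow, inv_inv, abs_of_pos (by positivity)]

theorem exists_schwartz_decay {V : Type*} [NormedAddCommGroup V] [NormedSpace ℝ V]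
    (H : 𝓢(V, ℂ)) (k : ℕ) : ∃ C : ℝ, 0 < C ∧ ∀ x, ‖H x‖ ≤ C * ((1 + ‖x‖) ^ k)⁻¹ := by
  refine ⟨2 ^ k * ((Finset.Iic (k, 0)).sup fun m => SchwartzMap.seminorm ℝ m.1 m.2) H + 1,
    by positivity, fun x => ?_⟩
  have h := SchwartzMap.one_add_le_sup_seminorm_apply (𝕜 := ℝ) (m := (k, 0)) (k := k) (n := 0)
    le_rfl le_rfl H x
  rw [norm_iteratedFDeriv_zero] at h
  rw [← div_eq_mul_inv, le_div_iff₀ (by positivity), mul_comm]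
  linarith

/-- The exponent `d` exceeds the dimension `d - 1`, and all the spaces `ν^⊥` are isometric, so one
constant serves every direction. -/
theorem lintegral_japanese_orthogonal {d : ℕ} (hd : 1 ≤ d) :
    ∃ I : ℝ, 0 < I ∧ ∀ ν : EuclideanSpace ℝ (Fin d), ‖ν‖ = 1 →
      ∫⁻ ω : (Submodule.span ℝ {ν})ᗮ, ENNReal.ofReal (((1 + ‖ω‖) ^ d)⁻¹) ≤ ENNReal.ofReal I := by
  have hfin : ∫⁻ x : EuclideanSpace ℝ (Fin (d - 1)), ENNReal.ofReal (((1 + ‖x‖) ^ d)⁻¹) < ∞ := by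
    have := finite_integral_one_add_norm (E := EuclideanSpace ℝ (Fin (d - 1))) (μ := volume)
      (r := d) (by simp; omega)
    refine lt_of_eq_of_lt ?_ this
    congr 1; ext x
    rw [Real.rpow_neg (by positivity), Real.rpow_natCast]
  refine ⟨(∫⁻ x : EuclideanSpace ℝ (Fin (d - 1)), ENNReal.ofReal (((1 + ‖x‖) ^ d)⁻¹)).toReal + 1,
    by positivity, fun ν hν => ?_⟩
  have hfr : Module.finrank ℝ (Submodule.span ℝ {ν})ᗮ = d - 1 := by
    have h1 := Submodule.finrank_add_finrank_orthogonal (Submodule.span ℝ {ν})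
    rw [finrank_span_singleton (by rintro rfl; simp at hν), finrank_euclideanSpace_fin] at h1
    omega
  let e := (stdOrthonormalBasis ℝ (Submodule.span ℝ {ν})ᗮ).reindex (finCongr hfr)
  have he := e.measurePreserving_repr
  have h2 := he.lintegral_comp (f := fun x => ENNReal.ofReal (((1 + ‖x‖) ^ d)⁻¹)) (by fun_prop)
  simp only [LinearIsometryEquiv.norm_map] at h2
  rw [h2, ENNReal.ofReal_add (by positivity) zero_le_one, ENNReal.ofReal_toReal hfin.ne]
  exact le_self_add

theorem lintegral_inv_one_add_sq_div {ρ : ℝ} (hρ : 0 < ρ) (t : ℝ) :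
    ∫⁻ l : ℝ, ENNReal.ofReal ((1 + ((l - t) / ρ) ^ 2)⁻¹) = ENNReal.ofReal (Real.pi * ρ) := by
  have h := lintegral_comp_inv_smul_sub (volume : Measure ℝ)
    (fun x => ENNReal.ofReal ((1 + x ^ 2)⁻¹)) hρ t
  simp only [smul_eq_mul, ← div_eq_inv_mul, Module.finrank_self, pow_one] at h
  rw [h, ← ofReal_integral_eq_lintegral_ofReal integrable_inv_one_add_sq
    (Filter.Eventually.of_forall fun x => by positivity), integral_univ_inv_one_add_sq,
    ← ENNReal.ofReal_mul hρ.le, mul_comm]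

/-- Both components of a vector are bounded by its norm, so the decay exponent `d + 2` can be
shared: two powers along `ν`, enough for integration in `l`, and `d` powers along `ν^⊥`. -/
theorem norm_dilate_translate_le {d : ℕ} {H : EuclideanSpace ℝ (Fin d) → ℂ} {C : ℝ} (hC : 0 < C)
    (hH : ∀ x, ‖H x‖ ≤ C * ((1 + ‖x‖) ^ (d + 2))⁻¹) {ρ : ℝ} (hρ : 0 < ρ)
    {ν : EuclideanSpace ℝ (Fin d)} (hν : ‖ν‖ = 1) (q : EuclideanSpace ℝ (Fin d)) (l : ℝ)
    (ω : (Submodule.span ℝ {ν})ᗮ) :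
    ‖H (ρ⁻¹ • (l • ν + (ω : EuclideanSpace ℝ (Fin d)) - q))‖ ≤
      C * (1 + ((l - ⟪ν, q⟫) / ρ) ^ 2)⁻¹ *
        ((1 + ‖ρ⁻¹ • (ω - (Submodule.span ℝ {ν})ᗮ.orthogonalProjectionOnto q)‖) ^ d)⁻¹ := by
  set y := ρ⁻¹ • (l • ν + (ω : EuclideanSpace ℝ (Fin d)) - q) with hy
  have hω : ⟪ν, (ω : EuclideanSpace ℝ (Fin d))⟫ = 0 :=
    Submodule.mem_orthogonal_singleton_iff_inner_right.1 ω.2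
  have h1 : |(l - ⟪ν, q⟫) / ρ| ≤ ‖y‖ := by
    have : (l - ⟪ν, q⟫) / ρ = ⟪ν, y⟫ := by
      simp only [hy, inner_smul_right, inner_sub_right, inner_add_right, hω,
        real_inner_self_eq_norm_sq, hν]
      field_simp
      ring
    rw [this]
    simpa [hν] using abs_real_inner_le_norm ν y
  have h2 : ‖ρ⁻¹ • (ω - (Submodule.span ℝ {ν})ᗮ.orthogonalProjectionOnto q)‖ ≤ ‖y‖ := by
    have : ρ⁻¹ • (ω - (Submodule.span ℝ {ν})ᗮ.orthogonalProjectionOnto q) =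
        (Submodule.span ℝ {ν})ᗮ.orthogonalProjectionOnto y := by
      have hz : (Submodule.span ℝ {ν})ᗮ.orthogonalProjectionOnto ν = 0 := by
        rw [Submodule.orthogonalProjectionOnto_eq_zero_iff]
        exact Submodule.le_orthogonal_orthogonal _ (Submodule.mem_span_singleton_self ν)
      simp [hy, hz]
    rw [this]
    exact Submodule.norm_orthogonalProjectionOnto_apply_le _ y
  refine (hH y).trans ?_
  rw [mul_assoc, ← mul_inv]
  gcongr
  rw [pow_add, mul_comm]
  have h3 : ((l - ⟪ν, q⟫) / ρ) ^ 2 ≤ ‖y‖ ^ 2 := by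
    rw [← sq_abs]; gcongr
  gcongr
  nlinarith [norm_nonneg y]

/-- Upper bound for the mixed norm of a superposition of translates whose projections onto every
line overlap boundedly. -/
theorem exists_mixedNormSq_le {d : ℕ} (hd : 1 ≤ d) (H : 𝓢(EuclideanSpace ℝ (Fin d), ℂ))
    (ι : Type*) :
    ∃ C : ℝ, 0 < C ∧ ∀ ρ : ℝ, 0 < ρ → ∀ (s : Finset ι) (q : ι → EuclideanSpace ℝ (Fin d))
      (h : EuclideanSpace ℝ (Fin d) → ℂ), (∀ x, h x = ∑ a ∈ s, H (ρ⁻¹ • (x - q a))) →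
      ∀ ν, ‖ν‖ = 1 → ∀ M : ℝ, (∀ l : ℝ, ∑ a ∈ s, (1 + ((l - ⟪ν, q a⟫) / ρ) ^ 2)⁻¹ ≤ M) →
        mixedNormSq ν h ≤ ENNReal.ofReal (C * M * s.card * ρ ^ (2 * (d - 1) + 1)) := by
  obtain ⟨C, hC, hH⟩ := exists_schwartz_decay H (d + 2)
  obtain ⟨I, hI, hI'⟩ := lintegral_japanese_orthogonal hd
  refine ⟨(C * I) ^ 2 * Real.pi, by positivity, fun ρ hρ s q h hh ν hν M hM => ?_⟩
  have hfr : Module.finrank ℝ (Submodule.span ℝ {ν})ᗮ = d - 1 := by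
    have h1 := Submodule.finrank_add_finrank_orthogonal (Submodule.span ℝ {ν})
    rw [finrank_span_singleton (by rintro rfl; simp at hν), finrank_euclideanSpace_fin] at h1
    omega
  set g : ι → ℝ → ℝ := fun a l => (1 + ((l - ⟪ν, q a⟫) / ρ) ^ 2)⁻¹ with hg
  have hg0 : ∀ a l, 0 ≤ g a l := fun a l => by positivity
  have hM0 : 0 ≤ M := (Finset.sum_nonneg fun a _ => hg0 a 0).trans (hM 0)
  have inner_le : ∀ l : ℝ, ∫⁻ ω : (Submodule.span ℝ {ν})ᗮ, ‖planeRestrict ν h l ω‖ₑ ≤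
      ENNReal.ofReal (C * I * ρ ^ (d - 1) * ∑ a ∈ s, g a l) := by
    intro l
    calc ∫⁻ ω : (Submodule.span ℝ {ν})ᗮ, ‖planeRestrict ν h l ω‖ₑ
        ≤ ∫⁻ ω : (Submodule.span ℝ {ν})ᗮ, ∑ a ∈ s, ENNReal.ofReal (C * g a l) * ENNReal.ofReal
            (((1 + ‖ρ⁻¹ • (ω - (Submodule.span ℝ {ν})ᗮ.orthogonalProjectionOnto (q a))‖) ^ d)⁻¹) := by
          apply lintegral_mono
          intro ω
          simp only [planeRestrict, hh]
          refine (enorm_sum_le _ _).trans (Finset.sum_le_sum fun a _ => ?_)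
          rw [← ENNReal.ofReal_mul (by have := hg0 a l; positivity), ← ofReal_norm]
          exact ENNReal.ofReal_le_ofReal (norm_dilate_translate_le hC hH hρ hν (q a) l ω)
      _ = ∑ a ∈ s, ENNReal.ofReal (C * g a l) * (ENNReal.ofReal (ρ ^ (d - 1)) *
            ∫⁻ ω : (Submodule.span ℝ {ν})ᗮ, ENNReal.ofReal (((1 + ‖ω‖) ^ d)⁻¹)) := by
          rw [lintegral_finsetSum']
          · refine Finset.sum_congr rfl fun a _ => ?_
            rw [lintegral_const_mul' _ _ ENNReal.ofReal_ne_top]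
            rw [lintegral_comp_inv_smul_sub volume
              (fun ω : (Submodule.span ℝ {ν})ᗮ => ENNReal.ofReal (((1 + ‖ω‖) ^ d)⁻¹)) hρ, hfr]
          · intro a _
            fun_prop
      _ ≤ ∑ a ∈ s, ENNReal.ofReal (C * I * ρ ^ (d - 1) * g a l) := by
          refine Finset.sum_le_sum fun a _ => ?_
          refine (mul_le_mul_right (mul_le_mul_right (hI' ν hν) _) _).trans (le_of_eq ?_)
          have := hg0 a l
          rw [← ENNReal.ofReal_mul (by positivity), ← ENNReal.ofReal_mul (by positivity)]
          congr 1; ring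
      _ = _ := by
          rw [← ENNReal.ofReal_sum_of_nonneg fun a _ => by have := hg0 a l; positivity,
            Finset.mul_sum]
  calc mixedNormSq ν h
      ≤ ∫⁻ l : ℝ, ∑ a ∈ s, ENNReal.ofReal ((C * I * ρ ^ (d - 1)) ^ 2 * M) *
          ENNReal.ofReal (g a l) := by
        apply lintegral_mono
        intro l
        have hs0 : 0 ≤ ∑ a ∈ s, g a l := Finset.sum_nonneg fun a _ => hg0 a l
        refine (pow_le_pow_left₀ (zero_le) (inner_le l) 2).trans ?_
        beta_reduce
        rw [← Finset.mul_sum, ← ENNReal.ofReal_sum_of_nonneg fun a _ => hg0 a l,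
          ← ENNReal.ofReal_mul (by positivity), ← ENNReal.ofReal_pow (by positivity)]
        apply ENNReal.ofReal_le_ofReal
        -- One factor of the square is bounded pointwise by the overlap `M` and only the other is
        -- integrated, so the bound is linear in the number of translates.
        have h1 := mul_le_mul_of_nonneg_right (hM l) hs0
        calc (C * I * ρ ^ (d - 1) * ∑ a ∈ s, g a l) ^ 2
            = (C * I * ρ ^ (d - 1)) ^ 2 * ((∑ a ∈ s, g a l) * ∑ a ∈ s, g a l) := by ring
          _ ≤ (C * I * ρ ^ (d - 1)) ^ 2 * (M * ∑ a ∈ s, g a l) := by gcongr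
          _ = _ := by ring
    _ = ∑ a ∈ s, ENNReal.ofReal ((C * I * ρ ^ (d - 1)) ^ 2 * M) * ENNReal.ofReal (Real.pi * ρ) := by
        rw [lintegral_finsetSum']
        · refine Finset.sum_congr rfl fun a _ => ?_
          rw [lintegral_const_mul' _ _ ENNReal.ofReal_ne_top, lintegral_inv_one_add_sq_div hρ]
        · intro a _
          fun_prop
    _ ≤ _ := by
        rw [Finset.sum_const, nsmul_eq_mul, ← ENNReal.ofReal_mul (by positivity),
          ← ENNReal.ofReal_natCast, ← ENNReal.ofReal_mul (by positivity)]
        apply ENNReal.ofReal_le_ofReal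
        apply le_of_eq
        ring

/-! ### Lacunary sequences and separation of subset sums. -/

/-- Shifting the index bounds `K` times the tail by the tail plus `M i`. -/
theorem sum_Ico_succ_le_of_lacunary {K : ℝ} {M : ℕ → ℝ} (hM0 : ∀ i, 0 ≤ M i)
    (hM : ∀ i, K * M (i + 1) ≤ M i) {i N : ℕ} (hi : i < N) :
    (K - 1) * ∑ j ∈ Finset.Ico (i + 1) N, M j ≤ M i := by
  have h1 : K * ∑ j ∈ Finset.Ico (i + 1) N, M j ≤ ∑ j ∈ Finset.Ico i N, M j := by
    obtain ⟨n, rfl⟩ : ∃ n, N = n + 1 := ⟨N - 1, by omega⟩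
    rw [← Finset.sum_Ico_add' M i n 1, Finset.mul_sum]
    refine (Finset.sum_le_sum fun j _ => hM j).trans ?_
    exact Finset.sum_le_sum_of_subset_of_nonneg
      (Finset.Ico_subset_Ico_right (by omega)) fun j _ _ => hM0 j
  rw [Finset.sum_eq_sum_Ico_succ_bot hi] at h1
  linarith

/-- Subset sums of a lacunary sequence are separated. -/
theorem lacunary_subset_sums_separated {K a b : ℝ} (ha : 0 < a) (hb : 0 < b)
    (hK : 1 + 2 * b / a ≤ K) {M τ : ℕ → ℝ} (hM0 : ∀ i, 0 ≤ M i) (hM : ∀ i, K * M (i + 1) ≤ M i)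
    {N : ℕ} {P Q : Finset ℕ} (hP : P ⊆ Finset.range N) (hQ : Q ⊆ Finset.range N) (hPQ : P ≠ Q)
    (hlow : ∀ i ∈ symmDiff P Q, a * M i ≤ |τ i|) (hup : ∀ i ∈ symmDiff P Q, |τ i| ≤ b * M i) :
    ∃ i < N, a / 2 * M i ≤ |∑ j ∈ P, τ j - ∑ j ∈ Q, τ j| := by
  have hne : (symmDiff P Q).Nonempty := by
    rw [Finset.nonempty_iff_ne_empty]
    intro h
    exact hPQ (symmDiff_eq_bot.1 h)
  -- The first index where `P` and `Q` differ contributes at least `a * M i`; since `K - 1 ≥ 2 * b /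
  -- a`, all later terms together cancel at most half of it.
  set i := (symmDiff P Q).min' hne with hi
  have himem : i ∈ symmDiff P Q := Finset.min'_mem _ _
  have hsub : symmDiff P Q ⊆ Finset.range N :=
    fun j hj => by
      rcases Finset.mem_symmDiff.1 hj with h | h
      exacts [hP h.1, hQ h.1]
  have hiN : i < N := Finset.mem_range.1 (hsub himem)
  refine ⟨i, hiN, ?_⟩
  set e : ℕ → ℝ := fun j => (if j ∈ P then 1 else 0) - (if j ∈ Q then 1 else 0) with he
  have he0 : ∀ j, j ∉ symmDiff P Q → e j = 0 := by
    intro j hj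
    rw [Finset.mem_symmDiff] at hj
    by_cases h1 : j ∈ P <;> by_cases h2 : j ∈ Q <;> simp_all
  have he1 : ∀ j, j ∈ symmDiff P Q → |e j| = 1 := by
    intro j hj
    rw [Finset.mem_symmDiff] at hj
    by_cases h1 : j ∈ P <;> by_cases h2 : j ∈ Q <;> simp_all
  have hsum : ∑ j ∈ P, τ j - ∑ j ∈ Q, τ j = ∑ j ∈ Finset.Ico i N, e j * τ j := by
    have h1 : ∀ T : Finset ℕ, T ⊆ Finset.range N →
        ∑ j ∈ T, τ j = ∑ j ∈ Finset.range N, (if j ∈ T then 1 else 0) * τ j := by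
      intro T hT
      simp only [ite_mul, one_mul, zero_mul, Finset.sum_ite_mem]
      rw [Finset.inter_eq_right.2 hT]
    rw [h1 P hP, h1 Q hQ, ← Finset.sum_sub_distrib]
    simp only [← sub_mul]
    symm
    apply Finset.sum_subset
    · intro j hj
      simp at hj ⊢
      exact hj.2
    · intro j hj hj2
      have : j ∉ symmDiff P Q := by
        intro h
        have := Finset.min'_le _ _ h
        simp at hj hj2
        omega
      rw [he0 j this, zero_mul]
  rw [hsum, Finset.sum_eq_sum_Ico_succ_bot hiN]
  have htail : |∑ j ∈ Finset.Ico (i + 1) N, e j * τ j| ≤ b * ∑ j ∈ Finset.Ico (i + 1) N, M j := by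
    rw [Finset.mul_sum]
    refine (Finset.abs_sum_le_sum_abs _ _).trans (Finset.sum_le_sum fun j _ => ?_)
    by_cases hj : j ∈ symmDiff P Q
    · rw [abs_mul, he1 j hj, one_mul]; exact hup j hj
    · rw [he0 j hj]
      have := hM0 j
      simp only [zero_mul, abs_zero]; positivity
  have hlac := sum_Ico_succ_le_of_lacunary hM0 hM hiN
  have hS0 : 0 ≤ ∑ j ∈ Finset.Ico (i + 1) N, M j := Finset.sum_nonneg fun j _ => hM0 j
  have h2 : 2 * b / a * ∑ j ∈ Finset.Ico (i + 1) N, M j ≤ M i :=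
    (mul_le_mul_of_nonneg_right (by linarith) hS0).trans hlac
  have h3 : 2 * b * ∑ j ∈ Finset.Ico (i + 1) N, M j ≤ a * M i := by
    calc 2 * b * ∑ j ∈ Finset.Ico (i + 1) N, M j
        = a * (2 * b / a * ∑ j ∈ Finset.Ico (i + 1) N, M j) := by field_simp
      _ ≤ _ := mul_le_mul_of_nonneg_left h2 ha.le
  have h4 : |e i * τ i| = |τ i| := by rw [abs_mul, he1 i himem, one_mul]
  have h5 := hlow i himem
  have h6 := abs_sub_abs_le_abs_add (e i * τ i) (∑ j ∈ Finset.Ico (i + 1) N, e j * τ j)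
  linarith

/-- For a vector whose coordinates decay geometrically at distinct rates, every linear functional
is dominated by one coordinate, up to a bounded number of exceptional indices, and so its subset
sums are separated away from these. -/
theorem exists_exceptional_subset_sums_separated {ι : Type*} [Fintype ι] [Nonempty ι] {α : ι → ℕ}
    (hα : Function.Injective α) (hα1 : ∀ k, 1 ≤ α k) {β : ℕ} (hβ : ∀ k, α k ≤ β) {c₁ c₂ K : ℝ}
    (hc₁ : 0 < c₁) (hc : c₁ ≤ c₂) (hK : 1 + 4 * Fintype.card ι * c₂ / c₁ ≤ K) {x : ℕ → ι → ℝ}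
    (hx₁ : ∀ i k, c₁ * (K⁻¹) ^ (i * α k) ≤ |x i k|) (hx₂ : ∀ i k, |x i k| ≤ c₂ * (K⁻¹) ^ (i * α k))
    (A : ι → ℝ) (N : ℕ) :
    ∃ J : Finset ℕ, J.card ≤ Fintype.card ι ^ 2 ∧ ∀ P ⊆ Finset.range N, ∀ Q ⊆ Finset.range N,
      P ∩ J = Q ∩ J → P ≠ Q → ∀ k, c₁ / 4 * |A k| * (K⁻¹) ^ (N * β) ≤
        |∑ i ∈ P, ∑ k, A k * x i k - ∑ i ∈ Q, ∑ k, A k * x i k| := by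
  classical
  set D : ℝ := ((Fintype.card ι : ℕ) : ℝ) with hD
  have hD1 : 1 ≤ D := by
    have : 1 ≤ Fintype.card ι := Fintype.card_pos
    rw [hD]
    exact_mod_cast this
  have hc₂ : 0 < c₂ := hc₁.trans_le hc
  set q := K⁻¹ with hq
  have hcc : 1 ≤ c₂ / c₁ := (one_le_div hc₁).2 hc
  have hL1 : 1 ≤ D * (c₂ / c₁) := one_le_mul_of_one_le_of_one_le hD1 hcc
  -- If one coordinate exceeds every other by the factor `L`, the others sum to at most `D * c₂ / L
  -- = c₁ / 2` times it, half of its guaranteed size.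
  set L : ℝ := 2 * D * c₂ / c₁ with hL
  have hLe : L = 2 * (D * (c₂ / c₁)) := by rw [hL]; ring
  have hKe : 1 + 4 * (D * (c₂ / c₁)) ≤ K := by
    refine le_trans (le_of_eq ?_) hK; ring
  have hKL : L ≤ K := by linarith
  have hK0 : 0 < K := by linarith
  have hK1 : 1 ≤ K := by linarith
  have hq0 : 0 < q := inv_pos.2 hK0
  have hKq : K * q = 1 := mul_inv_cancel₀ hK0.ne'
  have hq1 : q ≤ 1 := inv_le_one_of_one_le₀ hK1
  set a : ι → ℕ → ℝ := fun k i => |A k| * q ^ (i * α k) with ha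
  have ha0 : ∀ k i, 0 ≤ a k i := fun k i => by positivity
  set M : ℕ → ℝ := fun i => Finset.univ.sup' Finset.univ_nonempty fun k => a k i with hM
  have haM : ∀ k i, a k i ≤ M i := fun k i =>
    Finset.le_sup' (fun k => a k i) (Finset.mem_univ k)
  have hMa : ∀ i, ∃ k, M i = a k i := fun i => by
    obtain ⟨k, -, hk⟩ := Finset.exists_mem_eq_sup' Finset.univ_nonempty fun k => a k i
    exact ⟨k, hk⟩
  have hM0 : ∀ i, 0 ≤ M i := fun i => (ha0 (Classical.arbitrary ι) i).trans (haM _ i)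
  have hMlac : ∀ i, K * M (i + 1) ≤ M i := by
    intro i
    obtain ⟨k, hk⟩ := hMa (i + 1)
    rw [hk]
    refine le_trans ?_ (haM k i)
    have h1 : q ^ ((i + 1) * α k) ≤ q ^ (i * α k) * q := by
      rw [← pow_succ]
      apply pow_le_pow_of_le_one hq0.le hq1
      have := hα1 k
      nlinarith
    calc K * a k (i + 1) = K * (|A k| * q ^ ((i + 1) * α k)) := rfl
      _ ≤ K * (|A k| * (q ^ (i * α k) * q)) := by gcongr
      _ = (K * q) * a k i := by simp only [ha]; ring
      _ = a k i := by rw [hKq, one_mul]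
  -- An index is good when a single coordinate dominates by the factor `L`.
  set good : ℕ → Prop := fun i => ∃ k, ∀ l, l ≠ k → L * a l i ≤ a k i with hgood
  set J := (Finset.range N).filter fun i => ¬ good i with hJ
  have hbad : ∀ i, ¬ good i → ∃ kl : ι × ι, kl.2 ≠ kl.1 ∧ a kl.2 i ≤ a kl.1 i ∧
      a kl.1 i < L * a kl.2 i := by
    intro i hi
    obtain ⟨k, hk⟩ := hMa i
    simp only [hgood, not_exists, not_forall, not_le] at hi
    obtain ⟨l, hl, hl2⟩ := hi k
    exact ⟨(k, l), hl, hk ▸ haM l i, hl2⟩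
  choose! pr hpr using hbad
  -- The exponents being distinct, the ratio of two coordinates changes by a factor at least `K ≥ L`
  -- at each step, always in the same direction, so it lies in `[1, L)` for at most one index. Each
  -- pair thus accounts for at most one bad index, which bounds `J`.
  have key : ∀ i j : ℕ, i < j → ∀ k l : ι, l ≠ k → a l i ≤ a k i → a k i < L * a l i →
      a l j ≤ a k j → a k j < L * a l j → False := by
    intro i j hij k l hlk h1 h2 h3 h4
    obtain ⟨n, rfl⟩ : ∃ n, j = i + (n + 1) := ⟨j - i - 1, by omega⟩
    have hstep : ∀ k, a k (i + (n + 1)) = a k i * q ^ ((n + 1) * α k) := by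
      intro k
      simp only [ha]
      rw [add_mul, pow_add]; ring
    rw [hstep k, hstep l] at h3 h4
    rcases lt_or_gt_of_ne (hα.ne hlk) with h | h
    · have hp : q ^ ((n + 1) * α k) ≤ q ^ ((n + 1) * α l) * q := by
        rw [← pow_succ]
        apply pow_le_pow_of_le_one hq0.le hq1
        nlinarith
      have h5 : a l i * q ^ ((n + 1) * α l) ≤ a k i * (q ^ ((n + 1) * α l) * q) :=
        h3.trans (mul_le_mul_of_nonneg_left hp (ha0 _ _))
      have h6 : a l i ≤ a k i * q := by
        have : 0 < q ^ ((n + 1) * α l) := by positivity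
        nlinarith
      have h7 : K * a l i ≤ a k i := by
        calc K * a l i ≤ K * (a k i * q) := by gcongr
          _ = (K * q) * a k i := by ring
          _ = a k i := by rw [hKq, one_mul]
      have := mul_le_mul_of_nonneg_right hKL (ha0 l i)
      linarith
    · have hp : q ^ ((n + 1) * α l) ≤ q ^ ((n + 1) * α k) * q := by
        rw [← pow_succ]
        apply pow_le_pow_of_le_one hq0.le hq1
        nlinarith
      have hL0 : 0 ≤ L := by linarith
      have h5 : a k i * q ^ ((n + 1) * α k) < L * (a l i * (q ^ ((n + 1) * α k) * q)) :=
        h4.trans_le (by have := ha0 l i; gcongr)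
      have h6 : a k i < L * a l i * q := by
        have : 0 < q ^ ((n + 1) * α k) := by positivity
        nlinarith
      have h7 : L * a l i * q ≤ a l i := by
        calc L * a l i * q ≤ K * a l i * q := by have := ha0 l i; gcongr
          _ = (K * q) * a l i := by ring
          _ = a l i := by rw [hKq, one_mul]
      linarith
  refine ⟨J, ?_, ?_⟩
  · have : J.card ≤ (Finset.univ : Finset (ι × ι)).card := by
      apply Finset.card_le_card_of_injOn pr (fun _ _ => Finset.mem_univ _)
      intro i hi j hj hij
      simp only [hJ, Finset.coe_filter, mem_ofPred_eq] at hi hj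
      obtain ⟨u1, u2, u3⟩ := hpr i hi.2
      obtain ⟨v1, v2, v3⟩ := hpr j hj.2
      by_contra hne
      rw [← hij] at v1 v2 v3
      rcases lt_or_gt_of_ne hne with h | h
      · exact key i j h _ _ u1 u2 u3 v2 v3
      · exact key j i h _ _ u1 v2 v3 u2 u3
    simpa [sq] using this
  · intro P hP Q hQ hPQJ hPQ k
    -- Agreement on `J` leaves only good indices where `P` and `Q` differ.
    have hgoodmem : ∀ i ∈ symmDiff P Q, good i := by
      intro i hi
      by_contra hb
      have hiJ : i ∈ Finset.range N → i ∈ J := fun h => Finset.mem_filter.2 ⟨h, hb⟩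
      rcases Finset.mem_symmDiff.1 hi with h | h
      · have : i ∈ Q ∩ J := hPQJ ▸ Finset.mem_inter.2 ⟨h.1, hiJ (hP h.1)⟩
        exact h.2 (Finset.mem_inter.1 this).1
      · have : i ∈ P ∩ J := hPQJ.symm ▸ Finset.mem_inter.2 ⟨h.1, hiJ (hQ h.1)⟩
        exact h.2 (Finset.mem_inter.1 this).1
    -- With lower constant `c₁ / 2` and upper constant `D * c₂`, the condition `1 + 2 * b / a ≤ K`
    -- becomes the hypothesis on `K`.
    obtain ⟨i, hiN, hi⟩ := lacunary_subset_sums_separated (K := K) (a := c₁ / 2) (b := D * c₂)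
      (M := M) (τ := fun i => ∑ k, A k * x i k) (by positivity) (by positivity)
      (by refine le_trans (le_of_eq ?_) hKe; field_simp; ring) hM0 hMlac hP hQ hPQ
      (by
        intro i hi
        obtain ⟨k, hk⟩ := hgoodmem i hi
        have hMk : M i ≤ a k i := by
          obtain ⟨l, hl⟩ := hMa i
          rw [hl]
          by_cases h : l = k
          · rw [h]
          · have h1 := hk l h
            have h2 : 1 * a l i ≤ L * a l i := mul_le_mul_of_nonneg_right (by linarith) (ha0 l i)
            linarith
        have h1 : c₁ * a k i ≤ |A k * x i k| := by
          rw [abs_mul]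
          calc c₁ * a k i = |A k| * (c₁ * q ^ (i * α k)) := by simp only [ha]; ring
            _ ≤ _ := by gcongr; exact hx₁ i k
        have h2 : |∑ l ∈ Finset.univ.erase k, A l * x i l| ≤ c₁ / 2 * a k i := by
          calc |∑ l ∈ Finset.univ.erase k, A l * x i l|
              ≤ ∑ l ∈ Finset.univ.erase k, |A l * x i l| := Finset.abs_sum_le_sum_abs _ _
            _ ≤ ∑ l ∈ Finset.univ.erase k, c₂ * (a k i / L) := by
                refine Finset.sum_le_sum fun l hl => ?_
                rw [abs_mul]
                calc |A l| * |x i l| ≤ |A l| * (c₂ * q ^ (i * α l)) := by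
                      gcongr; exact hx₂ i l
                  _ = c₂ * a l i := by simp only [ha]; ring
                  _ ≤ c₂ * (a k i / L) := by
                      gcongr
                      rw [le_div_iff₀ (by linarith), mul_comm]
                      exact hk l (Finset.ne_of_mem_erase hl)
            _ ≤ D * (c₂ * (a k i / L)) := by
                rw [Finset.sum_const, nsmul_eq_mul]
                have : 0 ≤ c₂ * (a k i / L) := by
                  have := ha0 k i
                  have : 0 ≤ L := by linarith
                  positivity
                gcongr
                rw [hD]
                exact_mod_cast Finset.card_le_univ _
            _ = c₁ / 2 * a k i := by rw [hL]; field_simp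
        rw [← Finset.add_sum_erase _ _ (Finset.mem_univ k)]
        have h3 := abs_sub_abs_le_abs_add (A k * x i k) (∑ l ∈ Finset.univ.erase k, A l * x i l)
        have h4 : c₁ / 2 * M i ≤ c₁ / 2 * a k i := by gcongr
        linarith)
      (by
        intro i _
        calc |∑ l, A l * x i l| ≤ ∑ l, |A l * x i l| := Finset.abs_sum_le_sum_abs _ _
          _ ≤ ∑ l : ι, c₂ * M i := by
              refine Finset.sum_le_sum fun l _ => ?_
              rw [abs_mul]
              calc |A l| * |x i l| ≤ |A l| * (c₂ * q ^ (i * α l)) := by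
                    gcongr; exact hx₂ i l
                _ = c₂ * a l i := by simp only [ha]; ring
                _ ≤ c₂ * M i := by gcongr; exact haM l i
          _ = D * c₂ * M i := by
              rw [Finset.sum_const, nsmul_eq_mul, Finset.card_univ]; ring)
    refine le_trans ?_ hi
    have h1 : |A k| * q ^ (N * β) ≤ M i := by
      refine le_trans ?_ (haM k i)
      simp only [ha]
      apply mul_le_mul_of_nonneg_left _ (abs_nonneg _)
      apply pow_le_pow_of_le_one hq0.le hq1
      exact Nat.mul_le_mul hiN.le (hβ k)
    calc c₁ / 4 * |A k| * q ^ (N * β) = c₁ / 2 / 2 * (|A k| * q ^ (N * β)) := by ring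
      _ ≤ _ := by gcongr

/-! ### Bounded overlap of separated points on a line. -/

theorem summable_int_inv_one_add_sq : Summable fun n : ℤ => 3 * (1 + (n : ℝ) ^ 2)⁻¹ := by
  apply Summable.mul_left
  have h : Summable fun n : ℤ => ((n : ℝ) ^ 2)⁻¹ := by
    simpa using Real.summable_one_div_int_pow (p := 2) |>.2 one_lt_two
  have h0 : Summable fun n : ℤ => ((n : ℝ) ^ 2)⁻¹ + if n = 0 then 1 else 0 :=
    h.add (summable_of_ne_finset_zero (s := {0}) (by intro b hb; simp at hb; simp [hb]))
  refine Summable.of_nonneg_of_le (fun n => by positivity) (fun n => ?_) h0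
  by_cases hn : n = 0
  · simp [hn]
  · have : 0 < (n : ℝ) ^ 2 := by positivity
    simp only [hn, if_false, add_zero]
    gcongr
    linarith

/-- Separated points have distinct integer parts after rescaling, so the sum is dominated by a
convergent sum over the integers. If `n` is the integer part of `y`, then `n² ≤ 2y² + 2`, whence the
factor `3`. -/
theorem exists_sum_inv_one_add_sq_le_of_separated (β : Type*) :
    ∃ C : ℝ, 0 < C ∧ ∀ (s : Finset β) (τ : β → ℝ) (ρ : ℝ), 0 < ρ →
      (∀ a ∈ s, ∀ b ∈ s, a ≠ b → ρ ≤ |τ a - τ b|) →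
      ∀ l : ℝ, ∑ a ∈ s, (1 + ((l - τ a) / ρ) ^ 2)⁻¹ ≤ C := by
  have hsum := summable_int_inv_one_add_sq
  refine ⟨∑' n : ℤ, 3 * (1 + (n : ℝ) ^ 2)⁻¹, ?_, fun s τ ρ hρ hsep l => ?_⟩
  · exact hsum.tsum_pos (fun n => by positivity) 0 (by positivity)
  set φ : β → ℤ := fun a => ⌊(l - τ a) / ρ⌋ with hφ
  have hinj : Set.InjOn φ s := by
    intro a ha b hb hab
    by_contra hne
    have h1 := hsep a ha b hb hne
    have h2 := Int.abs_sub_lt_one_of_floor_eq_floor hab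
    rw [← sub_div, abs_div, abs_of_pos hρ, div_lt_one hρ] at h2
    have : l - τ a - (l - τ b) = -(τ a - τ b) := by ring
    rw [this, abs_neg] at h2
    linarith
  calc ∑ a ∈ s, (1 + ((l - τ a) / ρ) ^ 2)⁻¹
      ≤ ∑ a ∈ s, 3 * (1 + ((φ a : ℤ) : ℝ) ^ 2)⁻¹ := by
        refine Finset.sum_le_sum fun a _ => ?_
        set y := (l - τ a) / ρ
        have h1 : (φ a : ℝ) ≤ y := Int.floor_le _
        have h2 : y < φ a + 1 := Int.lt_floor_add_one _
        rw [← div_eq_mul_inv, inv_eq_one_div, div_le_div_iff₀ (by positivity) (by positivity)]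
        have h3 : (φ a : ℝ) ^ 2 ≤ 2 * y ^ 2 + 2 := by
          nlinarith [sq_nonneg (y + (φ a - y)), sq_nonneg (y - (φ a - y))]
        nlinarith [sq_nonneg y]
    _ = ∑ n ∈ s.image φ, 3 * (1 + (n : ℝ) ^ 2)⁻¹ :=
        (Finset.sum_image (f := fun n : ℤ => 3 * (1 + (n : ℝ) ^ 2)⁻¹) hinj).symm
    _ ≤ _ := hsum.sum_le_tsum _ fun n _ => by positivity

/-- Sorting the subsets by their trace on `J` gives at most `2 ^ D` families, each separated. -/
theorem exists_sum_powerset_inv_one_add_sq_le (D : ℕ) :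
    ∃ C : ℝ, 0 < C ∧ ∀ (N : ℕ) (J : Finset ℕ) (τ : Finset ℕ → ℝ) (ρ : ℝ), J.card ≤ D → 0 < ρ →
      (∀ P ⊆ Finset.range N, ∀ Q ⊆ Finset.range N, P ∩ J = Q ∩ J → P ≠ Q → ρ ≤ |τ P - τ Q|) →
      ∀ l : ℝ, ∑ P ∈ (Finset.range N).powerset, (1 + ((l - τ P) / ρ) ^ 2)⁻¹ ≤ C := by
  obtain ⟨C, hC, h⟩ := exists_sum_inv_one_add_sq_le_of_separated (Finset ℕ)
  refine ⟨2 ^ D * C, by positivity, fun N J τ ρ hJ hρ hsep l => ?_⟩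
  rw [← Finset.sum_fiberwise_of_maps_to (t := J.powerset) (g := fun P => P ∩ J)
    (fun P _ => Finset.mem_powerset.2 Finset.inter_subset_right)]
  calc _ ≤ ∑ B ∈ J.powerset, C := by
        refine Finset.sum_le_sum fun B _ => h _ τ ρ hρ ?_ l
        intro P hP Q hQ hPQ
        simp only [Finset.mem_filter, Finset.mem_powerset] at hP hQ
        exact hsep P hP.1 Q hQ.1 (hP.2.trans hQ.2.symm) hPQ
    _ ≤ _ := by
        rw [Finset.sum_const, Finset.card_powerset, nsmul_eq_mul]
        push_cast
        gcongr
        norm_num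

/-! ### Convolution of a Schwartz function with surface measure on a set. -/

section Convolution

variable {d : ℕ} {σ : Measure (EuclideanSpace ℝ (Fin d))} {T : Set (EuclideanSpace ℝ (Fin d))}

theorem convMeasure_indicator (hT : MeasurableSet T) (h : EuclideanSpace ℝ (Fin d) → ℂ)
    (x : EuclideanSpace ℝ (Fin d)) :
    convMeasure σ h (T.indicator fun _ => 1) x = ∫ y in T, h (x - y) ∂σ := by
  rw [convMeasure, ← integral_indicator hT]
  congr 1; ext y
  by_cases hy : y ∈ T <;> simp [hy]

theorem integrableOn_schwartz_sub (hσ : σ T < ∞) (h : 𝓢(EuclideanSpace ℝ (Fin d), ℂ))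
    (x : EuclideanSpace ℝ (Fin d)) : IntegrableOn (fun y => h (x - y)) T σ := by
  obtain ⟨C, hC, hd⟩ := exists_schwartz_decay h 0
  refine IntegrableOn.of_bound hσ (Continuous.aestronglyMeasurable (by fun_prop)) C
    (Filter.Eventually.of_forall fun y => ?_)
  simpa using hd (x - y)

theorem memLp_convMeasure_indicator (hT : MeasurableSet T) (hTb : Bornology.IsBounded T)
    (hσ : σ T < ∞) (h : 𝓢(EuclideanSpace ℝ (Fin d), ℂ)) :
    MemLp (convMeasure σ h (T.indicator fun _ => 1)) 2 volume := by
  have heq : convMeasure σ h (T.indicator fun _ => 1) = fun x => ∫ y in T, h (x - y) ∂σ :=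
    funext fun x => convMeasure_indicator hT h x
  rw [heq]
  have hfin : IsFiniteMeasure (σ.restrict T) := ⟨by simpa using hσ⟩
  obtain ⟨r, hr0, hr⟩ := hTb.exists_pos_norm_le
  obtain ⟨C, hC, hd⟩ := exists_schwartz_decay h (d + 1)
  have hcont : Continuous fun x => ∫ y in T, h (x - y) ∂σ := by
    obtain ⟨C, hC, hd⟩ := exists_schwartz_decay h 0
    refine continuous_of_dominated (bound := fun _ => C)
      (fun x => Continuous.aestronglyMeasurable (by fun_prop))
      (fun x => Filter.Eventually.of_forall fun y => ?_) (integrable_const C)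
      (Filter.Eventually.of_forall fun y => by fun_prop)
    simpa using hd (x - y)
  set C' : ℝ := C * (1 + r) ^ (d + 1) * σ.real T with hC'
  -- On the bounded set `T` one has `1 + ‖x‖ ≤ (1 + r)(1 + ‖x - y‖)`, so the Schwartz decay passes
  -- to the convolution.
  have hbound : ∀ x : EuclideanSpace ℝ (Fin d), ‖∫ y in T, h (x - y) ∂σ‖ ≤
      C' * (1 + ‖x‖) ^ (-((d + 1 : ℕ) : ℝ)) := by
    intro x
    have : C' * (1 + ‖x‖) ^ (-((d + 1 : ℕ) : ℝ)) =
        C * (1 + r) ^ (d + 1) * ((1 + ‖x‖) ^ (d + 1))⁻¹ * σ.real T := by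
      rw [Real.rpow_neg (by positivity), Real.rpow_natCast, hC']; ring
    rw [this]
    refine norm_setIntegral_le_of_norm_le_const hσ fun y hy => ?_
    refine (hd (x - y)).trans ?_
    rw [mul_assoc]
    gcongr
    rw [← div_eq_mul_inv, le_div_iff₀ (by positivity), inv_mul_le_iff₀ (by positivity), ← mul_pow]
    gcongr
    have h1 : ‖x‖ ≤ ‖x - y‖ + ‖y‖ := norm_le_norm_sub_add x y
    have h2 := hr y hy
    nlinarith [norm_nonneg (x - y)]
  have hint := integrable_one_add_norm (E := EuclideanSpace ℝ (Fin d)) (μ := volume)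
    (r := ((d + 1 : ℕ) : ℝ)) (by simp)
  rw [memLp_two_iff_integrable_sq_norm hcont.aestronglyMeasurable]
  refine ((hint.const_mul (C' ^ 2))).mono' (hcont.norm.pow 2).aestronglyMeasurable
    (Filter.Eventually.of_forall fun x => ?_)
  have hp : (1 + ‖x‖) ^ (-((d + 1 : ℕ) : ℝ)) ≤ 1 :=
    Real.rpow_le_one_of_one_le_of_nonpos (by linarith [norm_nonneg x])
      (neg_nonpos.2 (Nat.cast_nonneg _))
  have hp0 : 0 ≤ (1 + ‖x‖) ^ (-((d + 1 : ℕ) : ℝ)) := by positivity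
  rw [Real.norm_of_nonneg (by positivity)]
  calc ‖∫ y in T, h (x - y) ∂σ‖ ^ 2 ≤ (C' * (1 + ‖x‖) ^ (-((d + 1 : ℕ) : ℝ))) ^ 2 := by
        gcongr; exact hbound x
    _ = C' ^ 2 * ((1 + ‖x‖) ^ (-((d + 1 : ℕ) : ℝ)) * (1 + ‖x‖) ^ (-((d + 1 : ℕ) : ℝ))) := by ring
    _ ≤ C' ^ 2 * ((1 + ‖x‖) ^ (-((d + 1 : ℕ) : ℝ)) * 1) := by gcongr
    _ = _ := by ring

/-- The value of the convolution near `p + ∑ i ∈ P, u i` collects one contribution from each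
element of `P`. -/
theorem card_mul_le_enorm_convMeasure {h : 𝓢(EuclideanSpace ℝ (Fin d), ℂ)}
    {g : EuclideanSpace ℝ (Fin d) → ℝ} (hgc : Continuous g) {c ρ m : ℝ} (hc : 0 ≤ c) (hρ : 0 < ρ)
    (hg0 : ∀ x, 0 ≤ g x) (hgc2 : ∀ x, ‖x‖ ≤ 2 → c ≤ g x) {N : ℕ}
    {u : ℕ → EuclideanSpace ℝ (Fin d)} {p : EuclideanSpace ℝ (Fin d)}
    (hh : ∀ x, h x = ∑ P ∈ (Finset.range N).powerset, ((g (ρ⁻¹ • (x - ∑ i ∈ P, u i)) : ℝ) : ℂ))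
    (hT : MeasurableSet T) (hσ : σ T < ∞)
    (hTb : ∀ i < N, Metric.closedBall (p + u i) ρ ⊆ T)
    (hσm : ∀ i < N, ENNReal.ofReal m ≤ σ (Metric.closedBall (p + u i) ρ))
    {P : Finset ℕ} (hP : P ⊆ Finset.range N) {x : EuclideanSpace ℝ (Fin d)}
    (hx : x ∈ Metric.ball (p + ∑ i ∈ P, u i) ρ) :
    ENNReal.ofReal (P.card * (c * m)) ≤ ‖convMeasure σ h (T.indicator fun _ => 1) x‖ₑ := by
  rw [convMeasure_indicator hT]
  have hint : IntegrableOn (fun y => h (x - y)) T σ := integrableOn_schwartz_sub hσ h x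
  set G : Finset ℕ → EuclideanSpace ℝ (Fin d) → ℝ :=
    fun Q y => g (ρ⁻¹ • (x - y - ∑ i ∈ Q, u i)) with hG
  have hG0 : ∀ Q y, 0 ≤ G Q y := fun Q y => hg0 _
  have heq : ∀ y, h (x - y) = ((∑ Q ∈ (Finset.range N).powerset, G Q y : ℝ) : ℂ) := by
    intro y; rw [hh]; push_cast; rfl
  have hint' : IntegrableOn (fun y => ∑ Q ∈ (Finset.range N).powerset, G Q y) T σ := by
    have := hint.re
    refine this.congr (Filter.Eventually.of_forall fun y => ?_)
    simp [heq]
  have hintG : ∀ Q ∈ (Finset.range N).powerset, IntegrableOn (G Q) T σ := by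
    intro Q hQ
    refine hint'.mono' (Continuous.aestronglyMeasurable (by fun_prop))
      (Filter.Eventually.of_forall fun y => ?_)
    rw [Real.norm_of_nonneg (hG0 Q y)]
    exact Finset.single_le_sum (f := fun Q => G Q y) (fun Q _ => hG0 Q y) hQ
  simp_rw [heq]
  rw [integral_complex_ofReal, ← ofReal_norm, Complex.norm_real]
  apply ENNReal.ofReal_le_ofReal
  refine le_trans ?_ (le_abs_self _)
  rw [integral_finsetSum _ hintG]
  have hmem : ∀ i ∈ P, P.erase i ∈ (Finset.range N).powerset := fun i _ =>
    Finset.mem_powerset.2 ((Finset.erase_subset _ _).trans hP)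
  -- Different `i ∈ P` use different bumps `P.erase i`, and all bumps are nonnegative, so the
  -- contributions add up without repetition.
  have hinj : Set.InjOn (fun i => P.erase i) P := by
    intro i hi j hj hij
    by_contra hne
    have h1 : i ∈ P.erase j := Finset.mem_erase.2 ⟨hne, hi⟩
    have hij' : P.erase i = P.erase j := hij
    rw [← hij'] at h1
    exact Finset.notMem_erase i P h1
  calc (P.card : ℝ) * (c * m) = ∑ i ∈ P, c * m := by rw [Finset.sum_const, nsmul_eq_mul]
    _ ≤ ∑ i ∈ P, ∫ y in T, G (P.erase i) y ∂σ := by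
        refine Finset.sum_le_sum fun i hi => ?_
        have hiN := Finset.mem_range.1 (hP hi)
        have hfin : σ (Metric.closedBall (p + u i) ρ) < ∞ :=
          (measure_mono (hTb i hiN)).trans_lt hσ
        calc c * m ≤ c * σ.real (Metric.closedBall (p + u i) ρ) := by
              gcongr
              exact (ENNReal.ofReal_le_iff_le_toReal hfin.ne).1 (hσm i hiN)
          _ = ∫ y in Metric.closedBall (p + u i) ρ, c ∂σ := by
              rw [setIntegral_const, smul_eq_mul, mul_comm]
          _ ≤ ∫ y in Metric.closedBall (p + u i) ρ, G (P.erase i) y ∂σ := by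
              apply setIntegral_mono_on (integrableOn_const hfin.ne)
                ((hintG _ (hmem i hi)).mono_set (hTb i hiN)) measurableSet_closedBall
              intro y hy
              apply hgc2
              rw [norm_smul, norm_inv, Real.norm_of_nonneg hρ.le, inv_mul_le_iff₀ hρ]
              -- The centres match, leaving two errors of size at most `ρ`; this is why the bump is
              -- bounded below on the ball of radius `2`.
              have : x - y - ∑ j ∈ P.erase i, u j =
                  (x - (p + ∑ j ∈ P, u j)) - (y - (p + u i)) := by
                rw [← Finset.add_sum_erase _ _ hi]; abel
              rw [this]
              rw [Metric.mem_ball, dist_eq_norm] at hx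
              rw [Metric.mem_closedBall, dist_eq_norm] at hy
              have := norm_sub_le (x - (p + ∑ j ∈ P, u j)) (y - (p + u i))
              linarith
          _ ≤ _ := setIntegral_mono_set (hintG _ (hmem i hi))
              (Filter.Eventually.of_forall fun y => hG0 _ y)
              (Filter.Eventually.of_forall fun y hy => hTb i hiN hy)
    _ = ∑ Q ∈ P.image fun i => P.erase i, ∫ y in T, G Q y ∂σ :=
        (Finset.sum_image (f := fun Q => ∫ y in T, G Q y ∂σ) hinj).symm
    _ ≤ _ := by
        apply Finset.sum_le_sum_of_subset_of_nonneg
        · intro Q hQ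
          obtain ⟨i, hi, rfl⟩ := Finset.mem_image.1 hQ
          exact hmem i hi
        · intro Q _ _
          exact integral_nonneg fun y => hG0 Q y

end Convolution

/-! ### From a curve with distinct orders of vanishing to the logarithmic loss. -/

/-- Pairing each subset with its complement gives `k² + (N - k)² ≥ N² / 2`. -/
theorem sum_powerset_range_card_sq_ge (N : ℕ) :
    (2 : ℝ) ^ N * N ^ 2 / 4 ≤ ∑ P ∈ (Finset.range N).powerset, (P.card : ℝ) ^ 2 := by
  have h1 : ∑ P ∈ (Finset.range N).powerset, (P.card : ℝ) ^ 2 =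
      ∑ P ∈ (Finset.range N).powerset, ((N : ℝ) - P.card) ^ 2 := by
    apply Finset.sum_nbij' (fun P => Finset.range N \ P) (fun P => Finset.range N \ P)
    · intro P _; simp
    · intro P _; simp
    · intro P hP; exact Finset.sdiff_sdiff_eq_self (Finset.mem_powerset.1 hP)
    · intro P hP; exact Finset.sdiff_sdiff_eq_self (Finset.mem_powerset.1 hP)
    · intro P hP
      rw [Finset.cast_card_sdiff (Finset.mem_powerset.1 hP), Finset.card_range]
      ring
  have h2 : ∑ P ∈ (Finset.range N).powerset, (N : ℝ) ^ 2 / 2 ≤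
      ∑ P ∈ (Finset.range N).powerset, ((P.card : ℝ) ^ 2 + ((N : ℝ) - P.card) ^ 2) :=
    Finset.sum_le_sum fun P _ => by nlinarith [sq_nonneg ((N : ℝ) - 2 * P.card)]
  rw [Finset.sum_add_distrib, ← h1, Finset.sum_const, Finset.card_powerset, Finset.card_range,
    nsmul_eq_mul] at h2
  push_cast at h2
  linarith

theorem sum_ofReal_sq_mul_le_eLpNorm_sq {X : Type*} [MeasurableSpace X] {μ : Measure X} {β : Type*}
    {F : X → ℂ} {s : Finset β} {b : β → Set X} (hb : ∀ a ∈ s, MeasurableSet (b a))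
    (hdisj : (s : Set β).PairwiseDisjoint b) {w : β → ℝ}
    (hF : ∀ a ∈ s, ∀ x ∈ b a, ENNReal.ofReal (w a) ≤ ‖F x‖ₑ) :
    ∑ a ∈ s, ENNReal.ofReal (w a) ^ 2 * μ (b a) ≤ eLpNorm F 2 μ ^ 2 := by
  have h1 : eLpNorm F 2 μ ^ 2 = ∫⁻ x, ‖F x‖ₑ ^ 2 ∂μ := by
    have := eLpNorm_nnreal_pow_eq_lintegral (f := F) (μ := μ) (p := 2) two_ne_zero
    simpa using this
  rw [h1]
  calc ∑ a ∈ s, ENNReal.ofReal (w a) ^ 2 * μ (b a)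
      ≤ ∑ a ∈ s, ∫⁻ x in b a, ‖F x‖ₑ ^ 2 ∂μ := by
        refine Finset.sum_le_sum fun a ha => ?_
        rw [← setLIntegral_const]
        exact setLIntegral_mono' (hb a ha) fun x hx => pow_le_pow_left₀ (zero_le) (hF a ha x hx) 2
    _ = ∫⁻ x in ⋃ a ∈ s, b a, ‖F x‖ₑ ^ 2 ∂μ := (lintegral_biUnion_finset hdisj hb _).symm
    _ ≤ _ := setLIntegral_le_lintegral _ _

set_option maxHeartbeats 1000000 in
/-- The logarithmic lower bound, given points of the surface whose coordinates decay
geometrically at distinct rates. -/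
theorem exists_log_loss_of_curve {d : ℕ} (hd : 1 ≤ d) {S : Set (EuclideanSpace ℝ (Fin d))}
    {ι : Type*} [Fintype ι] [Nonempty ι] {α : ι → ℕ} (hα : Function.Injective α)
    (hα1 : ∀ k, 1 ≤ α k) (B : Module.Basis ι ℝ (EuclideanSpace ℝ (Fin d)))
    {p : EuclideanSpace ℝ (Fin d)} {γ : ℝ → EuclideanSpace ℝ (Fin d)} {c₁ c₂ b₁ b₂ r₀ : ℝ}
    (hc₁ : 0 < c₁) (hb₁ : 0 < b₁) (hb₂ : 0 < b₂) (hr₀ : 0 < r₀)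
    (hγ₁ : ∀ t ∈ Ioc (0 : ℝ) 1, ∀ k, c₁ * t ^ α k ≤ |B.repr (γ t - p) k|)
    (hγ₂ : ∀ t ∈ Ioc (0 : ℝ) 1, ∀ k, |B.repr (γ t - p) k| ≤ c₂ * t ^ α k)
    (hσ₁ : ∀ t ∈ Ioc (0 : ℝ) 1, ∀ r ∈ Ioc 0 r₀,
      ENNReal.ofReal (b₁ * r ^ (d - 1)) ≤ surfaceMeasure S (Metric.closedBall (γ t) r))
    (hσ₂ : ∀ t ∈ Ioc (0 : ℝ) 1, ∀ r ∈ Ioc 0 r₀,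
      surfaceMeasure S (Metric.closedBall (γ t) r) ≤ ENNReal.ofReal (b₂ * r ^ (d - 1))) :
    ∃ c : ℝ, 0 < c ∧ ∀ R : ℝ, 1 ≤ R →
      ∃ (f : EuclideanSpace ℝ (Fin d) → ℂ) (h : 𝓢(EuclideanSpace ℝ (Fin d), ℂ)),
        MemLp f 2 (surfaceMeasure S) ∧ eLpNorm f 2 (surfaceMeasure S) ≠ 0 ∧ h ≠ 0 ∧
        tsupport (𝓕 (h : EuclideanSpace ℝ (Fin d) → ℂ)) ⊆ Metric.ball 0 R ∧
        (∀ x, Integrable (fun y => h (x - y) * f y) (surfaceMeasure S)) ∧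
        MemLp (convMeasure (surfaceMeasure S) h f) 2 volume ∧
        ∀ ν : EuclideanSpace ℝ (Fin d), ‖ν‖ = 1 →
          ENNReal.ofReal (c * Real.log R) * eLpNorm f 2 (surfaceMeasure S) ^ 2 * mixedNormSq ν h
            ≤ eLpNorm (convMeasure (surfaceMeasure S) h f) 2 volume ^ 2 := by
  classical
  set σ := surfaceMeasure S with hσdef
  set D : ℝ := ((Fintype.card ι : ℕ) : ℝ) with hD
  have hD1 : 1 ≤ D := by
    have : 1 ≤ Fintype.card ι := Fintype.card_pos
    rw [hD]
    exact_mod_cast this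
  let k₀ : ι := Classical.arbitrary ι
  have hc : c₁ ≤ c₂ := by
    have h1 := (hγ₁ 1 ⟨one_pos, le_rfl⟩ k₀).trans (hγ₂ 1 ⟨one_pos, le_rfl⟩ k₀)
    simpa using h1
  have hc₂ : 0 < c₂ := hc₁.trans_le hc
  set β : ℕ := Finset.univ.sup' Finset.univ_nonempty α with hβdef
  have hβ : ∀ k, α k ≤ β := fun k => Finset.le_sup' α (Finset.mem_univ k)
  have hβ1 : 1 ≤ β := (hα1 k₀).trans (hβ k₀)
  set K : ℝ := 1 + 4 * D * c₂ / c₁ with hK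
  have hK1 : 1 < K := by
    have : 0 < 4 * D * c₂ / c₁ := by positivity
    linarith
  have hK0 : 0 < K := one_pos.trans hK1
  set q : ℝ := K⁻¹ with hq
  have hq0 : 0 < q := inv_pos.2 hK0
  have hq1 : q ≤ 1 := inv_le_one_of_one_le₀ hK1.le
  have hKq : K * q = 1 := mul_inv_cancel₀ hK0.ne'
  have hqmem : ∀ i : ℕ, q ^ i ∈ Ioc (0 : ℝ) 1 := fun i => ⟨by positivity, pow_le_one₀ hq0.le hq1⟩
  set u : ℕ → EuclideanSpace ℝ (Fin d) := fun i => γ (q ^ i) - p with hu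
  have hpu : ∀ i, p + u i = γ (q ^ i) := fun i => by simp [hu]
  have hx₁ : ∀ i k, c₁ * q ^ (i * α k) ≤ |B.repr (u i) k| := fun i k => by
    rw [pow_mul]; exact hγ₁ _ (hqmem i) k
  have hx₂ : ∀ i k, |B.repr (u i) k| ≤ c₂ * q ^ (i * α k) := fun i k => by
    rw [pow_mul]; exact hγ₂ _ (hqmem i) k

  obtain ⟨Cb, hCb, hcoord⟩ : ∃ Cb : ℝ, 0 < Cb ∧ ∀ x k, |B.repr x k| ≤ Cb * ‖x‖ := by
    refine ⟨‖(B.equivFunL : EuclideanSpace ℝ (Fin d) →L[ℝ] ι → ℝ)‖ + 1, by positivity,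
      fun x k => ?_⟩
    have h1 := (B.equivFunL : EuclideanSpace ℝ (Fin d) →L[ℝ] ι → ℝ).le_opNorm x
    have h2 := norm_le_pi_norm ((B.equivFunL : EuclideanSpace ℝ (Fin d) →L[ℝ] ι → ℝ) x) k
    have h3 : |B.repr x k| ≤ ‖(B.equivFunL : EuclideanSpace ℝ (Fin d) →L[ℝ] ι → ℝ) x‖ := by
      simpa using h2
    nlinarith [norm_nonneg x]
  -- Expanding `⟪ν, ν⟫ = 1` in the basis shows that the functional `⟪ν, ·⟫` has a coefficient
  -- bounded below independently of `ν`.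
  have hlarge : ∀ ν : EuclideanSpace ℝ (Fin d), ‖ν‖ = 1 → ∃ k, 1 / (D * Cb) ≤ |⟪ν, B k⟫| := by
    intro ν hν
    by_contra! hcon
    have h1 : (1 : ℝ) = ∑ k, B.repr ν k * ⟪ν, B k⟫ := by
      have h2 : ⟪ν, ν⟫ = 1 := by rw [real_inner_self_eq_norm_sq, hν]; norm_num
      rw [← h2]
      nth_rewrite 2 [← B.sum_repr ν]
      simp only [inner_sum, inner_smul_right]
    have h3 : ∑ k, B.repr ν k * ⟪ν, B k⟫ < ∑ k : ι, 1 / D := by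
      refine Finset.sum_lt_sum_of_nonempty Finset.univ_nonempty fun k _ => ?_
      refine (le_abs_self _).trans_lt ?_
      rw [abs_mul]
      have h4 : |B.repr ν k| ≤ Cb := by simpa [hν] using hcoord ν k
      calc |B.repr ν k| * |⟪ν, B k⟫| ≤ Cb * |⟪ν, B k⟫| := by gcongr
        _ < Cb * (1 / (D * Cb)) := by gcongr; exact hcon k
        _ = 1 / D := by field_simp
    rw [← h1, Finset.sum_const, Finset.card_univ, nsmul_eq_mul, ← hD, mul_one_div,
      div_self (by positivity)] at h3
    exact lt_irrefl _ h3
  -- The three bounds serve in turn the measure estimates at scale `ρ`, the separation of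
  -- projections, and the disjointness of the balls around the centres.
  set c₀ : ℝ := min r₀ (min (c₁ / 4 * (1 / (D * Cb))) (c₁ / (4 * Cb))) with hc₀
  have hc₀0 : 0 < c₀ := by positivity
  obtain ⟨H, g, cH, hcH, hHg, hg0, hgc, hHF⟩ :=
    exists_nonneg_bandlimited_schwartz (V := EuclideanSpace ℝ (Fin d))
      (κ := c₀ * q ^ β / 2) (by positivity)
  have hgcont : Continuous g := by
    have : g = fun x => (H x).re := by ext x; simp [hHg]
    rw [this]; fun_prop
  obtain ⟨M, hM, hMsum⟩ := exists_sum_powerset_inv_one_add_sq_le (Fintype.card ι ^ 2)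
  obtain ⟨Cm, hCm, hmixed⟩ := exists_mixedNormSq_le hd H (Finset ℕ)
  set v : ℝ := (volume (Metric.ball (0 : EuclideanSpace ℝ (Fin d)) 1)).toReal with hv
  have hv0 : 0 < v := ENNReal.toReal_pos (Metric.measure_ball_pos _ _ one_pos).ne'
    measure_ball_lt_top.ne
  have hlogK : 0 < Real.log K := Real.log_pos hK1
  refine ⟨cH ^ 2 * b₁ ^ 2 * v / (4 * β * Real.log K * b₂ * Cm * M), by positivity,
    fun R hR => ?_⟩
  have hlogR : 0 ≤ Real.log R := Real.log_nonneg hR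
  -- The floor gives `K ^ (n * β) ≤ R`, for the band limit; passing to `n + 1` gives `log R ≤ N β
  -- log K` and `N ≥ 1` even at `R = 1`. The lost factor `q ^ β` is built into the band limit of
  -- `H`.
  set n : ℕ := ⌊Real.log R / (β * Real.log K)⌋₊ with hn
  set N : ℕ := n + 1 with hN
  set ρ : ℝ := c₀ * q ^ (N * β) with hρdef
  have hρ : 0 < ρ := by positivity
  have hlogN : Real.log R ≤ N * (β * Real.log K) := by
    have h1 := (Nat.lt_floor_add_one (Real.log R / (β * Real.log K))).le
    rw [div_le_iff₀ (by positivity)] at h1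
    rw [hN]; push_cast; exact h1
  have hKR : K ^ (n * β) ≤ R := by
    have h1 : (n : ℝ) ≤ Real.log R / (β * Real.log K) := Nat.floor_le (by positivity)
    rw [le_div_iff₀ (by positivity)] at h1
    rw [← Real.log_le_log_iff (by positivity) (by linarith), Real.log_pow]
    push_cast
    linarith
  have hρR : c₀ * q ^ β ≤ ρ * R := by
    have h1 : 1 ≤ q ^ (n * β) * R := by
      calc (1 : ℝ) = q ^ (n * β) * K ^ (n * β) := by rw [← mul_pow, mul_comm, hKq, one_pow]
        _ ≤ _ := by gcongr
    calc c₀ * q ^ β = c₀ * q ^ β * 1 := by ring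
      _ ≤ c₀ * q ^ β * (q ^ (n * β) * R) := by gcongr
      _ = ρ * R := by rw [hρdef, hN, add_mul, pow_add]; ring
  have hqN : q ^ (N * β) ≤ 1 := pow_le_one₀ hq0.le hq1
  have hρr₀ : ρ ≤ r₀ := by
    calc ρ ≤ c₀ * 1 := by rw [hρdef]; gcongr
      _ ≤ r₀ := by rw [mul_one]; exact min_le_left _ _
  have hρmem : ρ ∈ Ioc 0 r₀ := ⟨hρ, hρr₀⟩
  obtain ⟨h, hh, hhF⟩ := exists_schwartz_sum_translates H hρ (Finset.range N).powerset
    (fun P => ∑ i ∈ P, u i)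
  have hhg : ∀ x, h x = ∑ P ∈ (Finset.range N).powerset,
      ((g (ρ⁻¹ • (x - ∑ i ∈ P, u i)) : ℝ) : ℂ) := fun x => by
    rw [hh]; simp only [hHg]
  set T : Set (EuclideanSpace ℝ (Fin d)) := ⋃ i ∈ Finset.range N, Metric.closedBall (p + u i) ρ
    with hT
  have hTm : MeasurableSet T := Finset.measurableSet_biUnion _ fun i _ => measurableSet_closedBall
  have hTb : Bornology.IsBounded T := by
    rw [hT, Bornology.isBounded_biUnion_finset]
    exact fun i _ => Metric.isBounded_closedBall
  have hballT : ∀ i < N, Metric.closedBall (p + u i) ρ ⊆ T := fun i hi =>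
    Set.subset_biUnion_of_mem (u := fun i => Metric.closedBall (p + u i) ρ)
      (Finset.mem_coe.2 (Finset.mem_range.2 hi))
  have hσT : σ T ≤ ENNReal.ofReal (N * (b₂ * ρ ^ (d - 1))) := by
    calc σ T ≤ ∑ i ∈ Finset.range N, σ (Metric.closedBall (p + u i) ρ) :=
          measure_biUnion_finset_le _ _
      _ ≤ ∑ i ∈ Finset.range N, ENNReal.ofReal (b₂ * ρ ^ (d - 1)) :=
          Finset.sum_le_sum fun i _ => by rw [hpu]; exact hσ₂ _ (hqmem i) _ hρmem
      _ = _ := by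
          rw [Finset.sum_const, Finset.card_range, nsmul_eq_mul,
            ENNReal.ofReal_mul (Nat.cast_nonneg N), ENNReal.ofReal_natCast]
  have hσTfin : σ T < ∞ := hσT.trans_lt ENNReal.ofReal_lt_top
  have hσlow : ∀ i < N, ENNReal.ofReal (b₁ * ρ ^ (d - 1)) ≤ σ (Metric.closedBall (p + u i) ρ) :=
    fun i _ => by rw [hpu]; exact hσ₁ _ (hqmem i) _ hρmem
  have hσTpos : σ T ≠ 0 := by
    have h1 := (hσlow 0 (by omega)).trans (measure_mono (hballT 0 (by omega)))
    exact ((ENNReal.ofReal_pos.2 (by positivity)).trans_le h1).ne'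
  have hfnorm : eLpNorm (T.indicator fun _ => (1 : ℂ)) 2 σ ^ 2 = σ T := by
    have h1 := eLpNorm_nnreal_pow_eq_lintegral (f := T.indicator fun _ => (1 : ℂ)) (μ := σ)
      (p := 2) two_ne_zero
    simp only [NNReal.coe_ofNat, ENNReal.coe_ofNat] at h1
    have h2 : ∀ x, ‖T.indicator (fun _ => (1 : ℂ)) x‖ₑ ^ (2 : ℝ) = T.indicator 1 x := by
      intro x
      by_cases hx : x ∈ T <;> simp [hx]
    simp_rw [h2] at h1
    rw [lintegral_indicator_one hTm] at h1
    exact_mod_cast h1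

  have hsepν : ∀ ν : EuclideanSpace ℝ (Fin d), ‖ν‖ = 1 → ∀ l : ℝ,
      ∑ P ∈ (Finset.range N).powerset, (1 + ((l - ⟪ν, ∑ i ∈ P, u i⟫) / ρ) ^ 2)⁻¹ ≤ M := by
    intro ν hν
    obtain ⟨k, hk⟩ := hlarge ν hν
    obtain ⟨J, hJ, hJsep⟩ := exists_exceptional_subset_sums_separated hα hα1 hβ hc₁ hc
      (K := K) le_rfl hx₁ hx₂ (fun k => ⟪ν, B k⟫) N
    refine hMsum N J (fun P => ⟪ν, ∑ i ∈ P, u i⟫) ρ hJ hρ fun P hP Q hQ hPQ hne => ?_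
    have h1 := hJsep P hP Q hQ hPQ hne k
    have h2 : ∀ x, ∑ k, ⟪ν, B k⟫ * B.repr x k = ⟪ν, x⟫ := by
      intro x
      nth_rewrite 2 [← B.sum_repr x]
      simp only [inner_sum, inner_smul_right]
      exact Finset.sum_congr rfl fun k _ => mul_comm _ _
    simp only [h2, ← inner_sum] at h1
    refine le_trans ?_ h1
    rw [hρdef]
    gcongr
    calc c₀ ≤ c₁ / 4 * (1 / (D * Cb)) := (min_le_right _ _).trans (min_le_left _ _)
      _ ≤ _ := by gcongr
  -- Unlike the projections, the centres are separated for all pairs without exception, since the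
  -- single coordinate `k₀` is already lacunary.
  have hsep : ∀ P ⊆ Finset.range N, ∀ Q ⊆ Finset.range N, P ≠ Q →
      2 * ρ ≤ ‖∑ i ∈ P, u i - ∑ i ∈ Q, u i‖ := by
    intro P hP Q hQ hne
    obtain ⟨i, hiN, hi⟩ := lacunary_subset_sums_separated (K := K) hc₁ hc₂
      (by
        rw [hK]
        have : 2 * c₂ / c₁ * 1 ≤ 2 * c₂ / c₁ * (2 * D) := by gcongr; linarith
        have h4 : 2 * c₂ / c₁ * (2 * D) = 4 * D * c₂ / c₁ := by ring
        linarith)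
      (M := fun i => q ^ (i * α k₀)) (τ := fun i => B.repr (u i) k₀)
      (fun i => by positivity)
      (fun i => by
        calc K * q ^ ((i + 1) * α k₀) ≤ K * (q ^ (i * α k₀) * q) := by
              gcongr
              rw [← pow_succ]
              apply pow_le_pow_of_le_one hq0.le hq1
              have := hα1 k₀
              nlinarith
          _ = (K * q) * q ^ (i * α k₀) := by ring
          _ ≤ q ^ (i * α k₀) := by rw [hKq, one_mul])
      hP hQ hne (fun i _ => hx₁ i k₀) (fun i _ => hx₂ i k₀)
    have h1 : ∑ j ∈ P, B.repr (u j) k₀ - ∑ j ∈ Q, B.repr (u j) k₀ =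
        B.repr (∑ i ∈ P, u i - ∑ i ∈ Q, u i) k₀ := by
      simp [map_sub, map_sum]
    rw [h1] at hi
    have h2 := hcoord (∑ i ∈ P, u i - ∑ i ∈ Q, u i) k₀
    have h3 : q ^ (N * β) ≤ q ^ (i * α k₀) :=
      pow_le_pow_of_le_one hq0.le hq1 (Nat.mul_le_mul hiN.le (hβ k₀))
    have h4 : c₁ / 2 * q ^ (N * β) ≤ c₁ / 2 * q ^ (i * α k₀) := by gcongr
    have h5 : c₀ ≤ c₁ / (4 * Cb) := (min_le_right _ _).trans (min_le_right _ _)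
    refine le_of_mul_le_mul_left ?_ hCb
    calc Cb * (2 * ρ) = 2 * Cb * q ^ (N * β) * c₀ := by rw [hρdef]; ring
      _ ≤ 2 * Cb * q ^ (N * β) * (c₁ / (4 * Cb)) := by gcongr
      _ = c₁ / 2 * q ^ (N * β) := by field_simp; ring
      _ ≤ _ := by linarith
  have hh0 : h ≠ 0 := by
    intro h0
    have h1 := hhg 0
    rw [h0, zero_apply] at h1
    have h2 : (0 : ℝ) = ∑ P ∈ (Finset.range N).powerset, g (ρ⁻¹ • (0 - ∑ i ∈ P, u i)) := by
      exact_mod_cast h1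
    have h3 := Finset.single_le_sum (f := fun P : Finset ℕ => g (ρ⁻¹ • (0 - ∑ i ∈ P, u i)))
      (fun P _ => hg0 _) (Finset.empty_mem_powerset (Finset.range N))
    have h4 := hgc 0 (by simp)
    simp only [Finset.sum_empty, sub_zero, smul_zero] at h3
    linarith
  refine ⟨T.indicator fun _ => 1, h, ?_, ?_, hh0, ?_, ?_,
    memLp_convMeasure_indicator hTm hTb hσTfin h, fun ν hν => ?_⟩
  · exact memLp_indicator_const 2 hTm 1 (Or.inr hσTfin.ne)
  · intro h0
    rw [h0] at hfnorm
    exact hσTpos (by rw [← hfnorm]; simp)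
  · have h1 : tsupport (𝓕 (h : EuclideanSpace ℝ (Fin d) → ℂ)) ⊆ Metric.closedBall 0 (R / 2) := by
      apply closure_minimal _ Metric.isClosed_closedBall
      intro ξ hξ
      by_contra hcon
      rw [mem_closedBall_zero_iff, not_le] at hcon
      apply hξ
      apply hhF
      apply hHF
      rw [norm_smul, Real.norm_of_nonneg hρ.le]
      have := mul_lt_mul_of_pos_left hcon hρ
      linarith
    exact h1.trans (Metric.closedBall_subset_ball (by linarith))
  · intro x
    have h1 := (integrable_indicator_iff hTm).2 (integrableOn_schwartz_sub hσTfin h x)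
    refine h1.congr (Filter.Eventually.of_forall fun y => ?_)
    by_cases hy : y ∈ T <;> simp [hy]
  · have hlow := sum_ofReal_sq_mul_le_eLpNorm_sq (μ := volume)
      (F := convMeasure σ h (T.indicator fun _ => 1)) (s := (Finset.range N).powerset)
      (b := fun P => Metric.ball (p + ∑ i ∈ P, u i) ρ)
      (w := fun P => P.card * (cH * (b₁ * ρ ^ (d - 1))))
      (fun P _ => measurableSet_ball)
      (by
        intro P hP Q hQ hne
        apply Metric.ball_disjoint_ball
        rw [dist_add_left, dist_eq_norm, ← two_mul]
        exact hsep P (Finset.mem_powerset.1 hP) Q (Finset.mem_powerset.1 hQ) hne)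
      (fun P hP x hx => card_mul_le_enorm_convMeasure hgcont hcH.le hρ hg0 hgc hhg hTm hσTfin hballT
        hσlow (Finset.mem_powerset.1 hP) hx)
    refine le_trans ?_ hlow
    have hvol : ∀ z : EuclideanSpace ℝ (Fin d),
        volume (Metric.ball z ρ) = ENNReal.ofReal (ρ ^ d * v) := by
      intro z
      rw [Measure.addHaar_ball_of_pos volume z hρ, ENNReal.ofReal_mul (by positivity), hv,
        ENNReal.ofReal_toReal measure_ball_lt_top.ne, finrank_euclideanSpace_fin]
    have hsumeq : ∑ P ∈ (Finset.range N).powerset,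
        ENNReal.ofReal (P.card * (cH * (b₁ * ρ ^ (d - 1)))) ^ 2 *
          volume (Metric.ball (p + ∑ i ∈ P, u i) ρ) =
        ENNReal.ofReal ((∑ P ∈ (Finset.range N).powerset, (P.card : ℝ) ^ 2) *
          ((cH * (b₁ * ρ ^ (d - 1))) ^ 2 * (ρ ^ d * v))) := by
      have hX : 0 ≤ (cH * (b₁ * ρ ^ (d - 1))) ^ 2 * (ρ ^ d * v) := by positivity
      rw [Finset.sum_mul, ENNReal.ofReal_sum_of_nonneg fun P _ => mul_nonneg (sq_nonneg _) hX]
      refine Finset.sum_congr rfl fun P _ => ?_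
      have hw : 0 ≤ (P.card : ℝ) * (cH * (b₁ * ρ ^ (d - 1))) := by positivity
      rw [hvol, ← ENNReal.ofReal_pow hw, ← ENNReal.ofReal_mul (pow_nonneg hw 2)]
      congr 1; ring
    rw [hsumeq, hfnorm]
    have hmix := hmixed ρ hρ (Finset.range N).powerset (fun P => ∑ i ∈ P, u i) h hh ν hν M
      (hsepν ν hν)
    rw [Finset.card_powerset, Finset.card_range] at hmix
    push_cast at hmix
    set c : ℝ := cH ^ 2 * b₁ ^ 2 * v / (4 * β * Real.log K * b₂ * Cm * M) with hcdef
    have hc0 : 0 < c := by positivity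
    -- Both sides now carry `2 ^ N * N ^ 2 * ρ ^ (3 * d - 2)`; on the left one `N` comes from `log
    -- R` and the other from `‖f‖²`.
    refine (mul_le_mul' (mul_le_mul' (ENNReal.ofReal_le_ofReal
      (mul_le_mul_of_nonneg_left hlogN hc0.le)) hσT) hmix).trans ?_
    rw [← ENNReal.ofReal_mul (by positivity), ← ENNReal.ofReal_mul (by positivity)]
    apply ENNReal.ofReal_le_ofReal
    refine le_trans (le_of_eq ?_) (mul_le_mul_of_nonneg_right (sum_powerset_range_card_sq_ge N)
      (by positivity))
    obtain ⟨m, rfl⟩ : ∃ m, d = m + 1 := ⟨d - 1, by omega⟩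
    have hβ0 : (β : ℝ) ≠ 0 := by positivity
    rw [hcdef, Nat.add_sub_cancel]
    field_simp
    ring

/-! ### Ahlfors regularity of surface measure. -/

section SurfaceMeasure

open scoped NNReal Topology

theorem LipschitzOnWith.euclideanHausdorffMeasure_image_le {X Y : Type*} [EMetricSpace X]
    [MeasurableSpace X] [BorelSpace X] [EMetricSpace Y] [MeasurableSpace Y] [BorelSpace Y]
    {K : ℝ≥0} {f : X → Y} {s : Set X} (h : LipschitzOnWith K f s) (m : ℕ) :
    Measure.euclideanHausdorffMeasure m (f '' s) ≤
      (K : ℝ≥0∞) ^ m * Measure.euclideanHausdorffMeasure m s := by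
  simp only [Measure.euclideanHausdorffMeasure_def, Measure.smul_apply, ENNReal.smul_def,
    smul_eq_mul]
  have h1 := h.hausdorffMeasure_image_le (d := m) (Nat.cast_nonneg m)
  rw [ENNReal.rpow_natCast] at h1
  calc _ ≤ _ := mul_le_mul_right h1 _
    _ = _ := by ring

variable {d : ℕ}

theorem finrank_orthogonal_span_singleton {a : EuclideanSpace ℝ (Fin d)} (ha : a ≠ 0) :
    Module.finrank ℝ (Submodule.span ℝ {a})ᗮ = d - 1 := by
  have h1 := Submodule.finrank_add_finrank_orthogonal (Submodule.span ℝ {a})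
  rw [finrank_span_singleton ha, finrank_euclideanSpace_fin] at h1
  omega

theorem exists_euclideanHausdorffMeasure_hyperplane_ball {a : EuclideanSpace ℝ (Fin d)}
    (ha : a ≠ 0) :
    ∃ v : ℝ, 0 < v ∧ ∀ ζ : EuclideanSpace ℝ (Fin d), ⟪a, ζ⟫ = 0 → ∀ s : ℝ, 0 ≤ s →
      Measure.euclideanHausdorffMeasure (d - 1) ({z | ⟪a, z⟫ = 0} ∩ Metric.closedBall ζ s) =
        ENNReal.ofReal (s ^ (d - 1) * v) := by
  set W := (Submodule.span ℝ {a})ᗮ with hW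
  refine ⟨(volume (Metric.closedBall (0 : W) 1)).toReal,
    ENNReal.toReal_pos (Metric.measure_closedBall_pos _ _ one_pos).ne'
      measure_closedBall_lt_top.ne, fun ζ hζ s hs => ?_⟩
  let ζ' : W := ⟨ζ, Submodule.mem_orthogonal_singleton_iff_inner_right.2 hζ⟩
  have himg : {z | ⟪a, z⟫ = 0} ∩ Metric.closedBall ζ s =
      ((↑) : W → EuclideanSpace ℝ (Fin d)) '' Metric.closedBall ζ' s := by
    ext z
    constructor
    · rintro ⟨hz, hzs⟩
      exact ⟨⟨z, Submodule.mem_orthogonal_singleton_iff_inner_right.2 hz⟩, hzs, rfl⟩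
    · rintro ⟨z, hz, rfl⟩
      exact ⟨Submodule.mem_orthogonal_singleton_iff_inner_right.1 z.2, hz⟩
  have hfr : Module.finrank ℝ W = d - 1 := finrank_orthogonal_span_singleton ha
  rw [himg, isometry_subtype_coe.euclideanHausdorffMeasure_image, ← hfr,
    InnerProductSpace.euclideanHausdorffMeasure_eq_volume, Measure.addHaar_closedBall' _ _ hs,
    ENNReal.ofReal_mul (by positivity), ENNReal.ofReal_toReal measure_closedBall_lt_top.ne]

/-- A hypersurface with a `C¹` slice chart at `p` is Ahlfors regular near `p`. -/
theorem exists_surfaceMeasure_closedBall_bounds {S : Set (EuclideanSpace ℝ (Fin d))}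
    {φ : OpenPartialHomeomorph (EuclideanSpace ℝ (Fin d)) (EuclideanSpace ℝ (Fin d))}
    {p a : EuclideanSpace ℝ (Fin d)} (hp : p ∈ φ.source) (hφ : ContDiffAt ℝ 1 φ p)
    (hψ : ContDiffAt ℝ 1 φ.symm (φ p)) (ha : a ≠ 0)
    (hS : ∀ᶠ x in 𝓝 p, x ∈ S ↔ ⟪a, φ x⟫ = 0) :
    ∃ b₁ b₂ r₀ : ℝ, 0 < b₁ ∧ 0 < b₂ ∧ 0 < r₀ ∧ ∀ ξ ∈ S, ξ ∈ Metric.ball p r₀ → ∀ r ∈ Ioc 0 r₀,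
      ENNReal.ofReal (b₁ * r ^ (d - 1)) ≤ surfaceMeasure S (Metric.closedBall ξ r) ∧
      surfaceMeasure S (Metric.closedBall ξ r) ≤ ENNReal.ofReal (b₂ * r ^ (d - 1)) := by
  obtain ⟨v, hv, hball⟩ := exists_euclideanHausdorffMeasure_hyperplane_ball ha
  obtain ⟨K, U, hU, hK⟩ := hφ.exists_lipschitzOnWith
  obtain ⟨L, V, hV, hL⟩ := hψ.exists_lipschitzOnWith
  have hcont : ContinuousAt φ p := φ.continuousAt hp
  have hcont' : ContinuousAt φ.symm (φ p) := φ.continuousAt_symm (φ.map_source hp)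
  obtain ⟨δ, hδ, hδ'⟩ := Metric.eventually_nhds_iff_ball.1
    (((Filter.eventually_of_mem hU fun x hx => hx).and
      (φ.open_source.eventually_mem hp)).and (hS.and (hcont.eventually_mem hV)))
  have hδs : Metric.ball p δ ∈ 𝓝 (φ.symm (φ p)) := by
    rw [φ.left_inv hp]; exact Metric.ball_mem_nhds _ hδ
  obtain ⟨η, hη, hη'⟩ := Metric.eventually_nhds_iff_ball.1
    (((Filter.eventually_of_mem hV fun x hx => hx).and
      (φ.open_target.eventually_mem (φ.map_source hp))).and (hcont'.eventually_mem hδs))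
  -- Both chart maps are Lipschitz near the point, so the measure of a surface ball is comparable to
  -- that of a hyperplane ball. Adding `1` makes the constants at least `1`, so that one can divide
  -- by them.
  set K' : ℝ := K + 1 with hK'
  set L' : ℝ := L + 1 with hL'
  have hK0 : (0 : ℝ) ≤ K := K.2
  have hL0 : (0 : ℝ) ≤ L := L.2
  have hK'1 : 1 ≤ K' := by linarith
  have hL'1 : 1 ≤ L' := by linarith
  -- The first bound keeps balls around `ξ` inside the chart neighbourhood; the second keeps the
  -- hyperplane balls of the lower estimate inside the neighbourhood of `φ p`.
  set r₀ : ℝ := min (δ / 2) (η / (2 * K')) with hr₀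
  have hr₀0 : 0 < r₀ := by positivity
  have hr₀δ : r₀ ≤ δ / 2 := min_le_left _ _
  have hr₀η : K' * r₀ ≤ η / 2 := by
    calc K' * r₀ ≤ K' * (η / (2 * K')) := by gcongr; exact min_le_right _ _
      _ = η / 2 := by field_simp
  have hmeas : ∀ ξ r, surfaceMeasure S (Metric.closedBall ξ r) =
      Measure.euclideanHausdorffMeasure (d - 1) (Metric.closedBall ξ r ∩ S) := fun ξ r => by
    rw [surfaceMeasure, Measure.restrict_apply measurableSet_closedBall]
  refine ⟨v / (L' ^ (d - 1) * K' ^ (d - 1)), v * L' ^ (d - 1) * K' ^ (d - 1), r₀, by positivity,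
    by positivity, hr₀0, fun ξ hξS hξ r hr => ?_⟩
  have hξδ : ξ ∈ Metric.ball p δ := Metric.ball_subset_ball (by linarith) hξ
  have hζ : ⟪a, φ ξ⟫ = 0 := ((hδ' ξ hξδ).2.1).1 hξS
  rw [Metric.mem_ball] at hξ hξδ
  have hζη : dist (φ ξ) (φ p) ≤ η / 2 := by
    have h1 := hK.dist_le_mul ξ (hδ' ξ hξδ).1.1 p (hδ' p (Metric.mem_ball_self hδ)).1.1
    nlinarith [dist_nonneg (x := ξ) (y := p)]
  have hr0 := hr.1
  have hsubδ : Metric.closedBall ξ r ⊆ Metric.ball p δ := by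
    intro x hx
    rw [Metric.mem_closedBall] at hx
    rw [Metric.mem_ball]
    linarith [dist_triangle x ξ p, hr.2]
  rw [hmeas]
  constructor
  · set A := {z | ⟪a, z⟫ = 0} ∩ Metric.closedBall (φ ξ) (r / L') with hA
    have hAη : ∀ z ∈ A, z ∈ Metric.ball (φ p) η := by
      rintro z ⟨-, hz⟩
      rw [Metric.mem_closedBall] at hz
      rw [Metric.mem_ball]
      have h1 : r / L' ≤ r := div_le_self hr0.le hL'1
      have h2 : r₀ ≤ K' * r₀ := le_mul_of_one_le_left hr₀0.le hK'1
      have h3 := dist_triangle z (φ ξ) (φ p)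
      have h4 : dist (φ ξ) (φ p) < η / 2 := by
        have h1 := hK.dist_le_mul ξ (hδ' ξ hξδ).1.1 p (hδ' p (Metric.mem_ball_self hδ)).1.1
        nlinarith [dist_nonneg (x := ξ) (y := p)]
      linarith [hr.2]
    have hζη' : φ ξ ∈ Metric.ball (φ p) η := by
      rw [Metric.mem_ball]; linarith
    have hsub : A ⊆ φ '' (Metric.closedBall ξ r ∩ S) := by
      intro z hz
      have hz1 := hη' z (hAη z hz)
      refine ⟨φ.symm z, ⟨?_, ?_⟩, φ.right_inv hz1.1.2⟩
      · have h1 := hL.dist_le_mul z hz1.1.1 (φ ξ) (hη' _ hζη').1.1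
        rw [φ.left_inv (hδ' ξ hξδ).1.2] at h1
        rw [Metric.mem_closedBall]
        refine h1.trans ?_
        have h2 : dist z (φ ξ) ≤ r / L' := hz.2
        calc (L : ℝ) * dist z (φ ξ) ≤ L' * (r / L') := by gcongr; linarith
          _ = r := by field_simp
      · rw [(hδ' _ hz1.2).2.1, φ.right_inv hz1.1.2]
        exact hz.1
    have hlip : LipschitzOnWith K φ (Metric.closedBall ξ r ∩ S) :=
      hK.mono fun x hx => (hδ' x (hsubδ hx.1)).1.1
    have h1 : ENNReal.ofReal ((r / L') ^ (d - 1) * v) ≤ ENNReal.ofReal (K' ^ (d - 1)) *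
        Measure.euclideanHausdorffMeasure (d - 1) (Metric.closedBall ξ r ∩ S) := by
      rw [← hball (φ ξ) hζ (r / L') (by positivity)]
      refine (measure_mono hsub).trans ((hlip.euclideanHausdorffMeasure_image_le (d - 1)).trans ?_)
      gcongr
      rw [ENNReal.ofReal_pow (by positivity)]
      gcongr
      rw [← ENNReal.ofReal_coe_nnreal]
      exact ENNReal.ofReal_le_ofReal (by linarith)
    have h2 : v / (L' ^ (d - 1) * K' ^ (d - 1)) * r ^ (d - 1) =
        ((r / L') ^ (d - 1) * v) / K' ^ (d - 1) := by
      rw [div_pow]; field_simp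
    rw [h2, ENNReal.ofReal_div_of_pos (by positivity)]
    exact ENNReal.div_le_of_le_mul' h1
  · have hsub : Metric.closedBall ξ r ∩ S ⊆
        φ.symm '' (({z | ⟪a, z⟫ = 0} ∩ Metric.closedBall (φ ξ) (K' * r)) ∩ V) := by
      rintro x ⟨hx, hxS⟩
      have hxδ := hδ' x (hsubδ hx)
      refine ⟨φ x, ⟨⟨hxδ.2.1.1 hxS, ?_⟩, hxδ.2.2⟩, φ.left_inv hxδ.1.2⟩
      have h1 := hK.dist_le_mul x hxδ.1.1 ξ (hδ' ξ hξδ).1.1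
      rw [Metric.mem_closedBall] at hx ⊢
      refine h1.trans ?_
      gcongr
      linarith
    have hlip : LipschitzOnWith L φ.symm
        (({z | ⟪a, z⟫ = 0} ∩ Metric.closedBall (φ ξ) (K' * r)) ∩ V) := hL.mono inter_subset_right
    refine (measure_mono hsub).trans ((hlip.euclideanHausdorffMeasure_image_le (d - 1)).trans ?_)
    calc (L : ℝ≥0∞) ^ (d - 1) * _ ≤ ENNReal.ofReal (L' ^ (d - 1)) *
          Measure.euclideanHausdorffMeasure (d - 1)
            ({z | ⟪a, z⟫ = 0} ∩ Metric.closedBall (φ ξ) (K' * r)) := by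
          refine mul_le_mul' ?_ (measure_mono inter_subset_left)
          rw [ENNReal.ofReal_pow (by positivity)]
          gcongr
          rw [← ENNReal.ofReal_coe_nnreal]
          exact ENNReal.ofReal_le_ofReal (by linarith)
      _ = _ := by
          rw [hball (φ ξ) hζ _ (by positivity), ← ENNReal.ofReal_mul (by positivity)]
          congr 1
          rw [mul_pow]; ring

end SurfaceMeasure

/-! ### A curve with distinct orders of vanishing at a curved point. -/

section Curve

open scoped Topology
open Filter Asymptotics

/-- Second order Taylor expansion of a `C²` map, with the Peano form of the remainder. -/
theorem ContDiffAt.taylor_two_isLittleO {E F : Type*} [NormedAddCommGroup E] [NormedSpace ℝ E]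
    [NormedAddCommGroup F] [NormedSpace ℝ F] {f : E → F} {z : E} (hf : ContDiffAt ℝ 2 f z) :
    (fun w => f (z + w) - f z - fderiv ℝ f z w - (2⁻¹ : ℝ) • fderiv ℝ (fderiv ℝ f) z w w)
      =o[𝓝 0] fun w => ‖w‖ ^ 2 := by
  set T := fderiv ℝ f z with hT
  set D := fderiv ℝ (fderiv ℝ f) z with hD
  have hsymm : ∀ v w, D v w = D w v := fun v w =>
    hf.isSymmSndFDerivAt (by simp) v w
  have hdiff2 : HasFDerivAt (fderiv ℝ f) D z :=
    ((hf.fderiv_right (m := 1) (by norm_num)).differentiableAt one_ne_zero).hasFDerivAt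
  have hdiff : ∀ᶠ w in 𝓝 (0 : E), HasFDerivAt f (fderiv ℝ f (z + w)) (z + w) := by
    have h1 : ∀ᶠ y in 𝓝 z, ContDiffAt ℝ 2 f y := hf.eventually (by simp)
    have h2 : Tendsto (fun w : E => z + w) (𝓝 0) (𝓝 z) := by
      have : Continuous fun w : E => z + w := by fun_prop
      simpa using this.tendsto 0
    filter_upwards [h2.eventually h1] with w hw
    exact (hw.differentiableAt two_ne_zero).hasFDerivAt
  rw [isLittleO_iff]
  intro ε hε
  have hlit := (hasFDerivAt_iff_isLittleO_nhds_zero.1 hdiff2)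
  rw [isLittleO_iff] at hlit
  obtain ⟨δ, hδ, hδ'⟩ := Metric.eventually_nhds_iff_ball.1 ((hlit hε).and hdiff)
  rw [Metric.eventually_nhds_iff_ball]
  refine ⟨δ, hδ, fun w hw => ?_⟩
  rw [mem_ball_zero_iff] at hw
  -- Symmetry of `D` makes the derivative of the remainder at `y` equal to `fderiv ℝ f (z + y) - T -
  -- D y`, at most `ε * ‖w‖`; the mean value inequality supplies the second factor `‖w‖`.
  set G : E → F := fun w => f (z + w) - f z - T w - (2⁻¹ : ℝ) • D w w with hG
  have hG' : ∀ y ∈ Metric.closedBall (0 : E) ‖w‖,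
      HasFDerivWithinAt G (fderiv ℝ f (z + y) - T - D y) (Metric.closedBall 0 ‖w‖) y := by
    intro y hy
    rw [mem_closedBall_zero_iff] at hy
    have h1 := (hδ' y (by rw [mem_ball_zero_iff]; linarith)).2
    have h2 : HasFDerivAt (fun w => f (z + w)) (fderiv ℝ f (z + y)) y := by
      have := h1.comp y ((hasFDerivAt_id y).const_add z)
      simpa using! this
    have h3 : HasFDerivAt (fun w => D w w) (D y + D.flip y) y := by
      have := (D.hasFDerivAt (x := y)).clm_apply (hasFDerivAt_id y)
      simpa using! this
    have h4 := ((h2.sub_const (f z)).sub (T.hasFDerivAt (x := y))).sub (h3.const_smul (2⁻¹ : ℝ))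
    refine HasFDerivAt.hasFDerivWithinAt (h4.congr_fderiv ?_)
    ext v
    simp only [_root_.sub_apply, _root_.smul_apply,
      _root_.add_apply, ContinuousLinearMap.flip_apply, hsymm v y]
    rw [← two_smul ℝ (D y v), smul_smul]
    norm_num
  have hbound : ∀ y ∈ Metric.closedBall (0 : E) ‖w‖,
      ‖fderiv ℝ f (z + y) - T - D y‖ ≤ ε * ‖w‖ := by
    intro y hy
    rw [mem_closedBall_zero_iff] at hy
    refine (hδ' y (by rw [mem_ball_zero_iff]; linarith)).1.trans ?_
    gcongr
  have := (convex_closedBall (0 : E) ‖w‖).norm_image_sub_le_of_norm_hasFDerivWithin_le hG' hbound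
    (Metric.mem_closedBall_self (norm_nonneg w)) (mem_closedBall_zero_iff.2 le_rfl)
  simp only [sub_zero] at this
  have hG0 : G 0 = 0 := by simp [hG]
  rw [hG0, sub_zero] at this
  refine this.trans (le_of_eq ?_)
  rw [Real.norm_of_nonneg (by positivity)]
  ring

/-- A linear automorphism can move any nonzero vector to any other. This lets the tangential basis
begin with the curved direction. -/
theorem exists_basis_apply_eq {W : Type*} [NormedAddCommGroup W] [InnerProductSpace ℝ W]
    [FiniteDimensional ℝ W] {m : ℕ} (hm : Module.finrank ℝ W = m) (k : Fin m) {w : W}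
    (hw : w ≠ 0) : ∃ b : Module.Basis (Fin m) ℝ W, b k = w := by
  let b₀ := Module.finBasisOfFinrankEq ℝ W hm
  obtain ⟨A, hA⟩ := SeparatingDual.exists_continuousLinearEquiv_apply_eq (R := ℝ)
    (b₀.ne_zero k) hw
  exact ⟨b₀.map A.toLinearEquiv, by simpa using hA⟩

variable {d : ℕ}

/-- Near a point where a hypersurface is curved, it contains a curve whose coordinates in some
basis have pairwise distinct orders of vanishing. -/
theorem exists_curve_of_second_fundamental_form_ne_zero
    {ψ : EuclideanSpace ℝ (Fin d) → EuclideanSpace ℝ (Fin d)}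
    {z a w n : EuclideanSpace ℝ (Fin d)} (hψ : ContDiffAt ℝ 2 ψ z)
    (hinj : Function.Injective (fderiv ℝ ψ z)) (ha : a ≠ 0) (hw : ⟪a, w⟫ = 0)
    (hn : ∀ v, ⟪a, v⟫ = 0 → ⟪n, fderiv ℝ ψ z v⟫ = 0)
    (hQ : ⟪n, fderiv ℝ (fderiv ℝ ψ) z w w⟫ ≠ 0) :
    ∃ (α : Option (Fin (d - 1)) → ℕ) (B : Module.Basis (Option (Fin (d - 1))) ℝ
      (EuclideanSpace ℝ (Fin d))) (W : ℝ → EuclideanSpace ℝ (Fin d)) (c₁ c₂ : ℝ),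
      Function.Injective α ∧ (∀ k, 1 ≤ α k) ∧ 0 < c₁ ∧ (∀ t, ⟪a, W t⟫ = 0) ∧
      Tendsto W (𝓝[>] 0) (𝓝 0) ∧ ∀ᶠ t in 𝓝[>] (0 : ℝ), ∀ k,
        c₁ * t ^ α k ≤ |B.repr (ψ (z + W t) - ψ z) k| ∧
        |B.repr (ψ (z + W t) - ψ z) k| ≤ c₂ * t ^ α k := by
  set T := fderiv ℝ ψ z with hT
  set D := fderiv ℝ (fderiv ℝ ψ) z with hD
  set m := d - 1 with hmdef
  have hw0 : w ≠ 0 := by rintro rfl; simp at hQ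
  have hn0 : n ≠ 0 := by rintro rfl; simp at hQ
  have hnn : ⟪n, n⟫ ≠ 0 := inner_self_ne_zero.2 hn0
  set A := (Submodule.span ℝ {a})ᗮ with hA
  have hAmem : ∀ v, v ∈ A ↔ ⟪a, v⟫ = 0 := fun v =>
    Submodule.mem_orthogonal_singleton_iff_inner_right
  have hfr : Module.finrank ℝ A = m := finrank_orthogonal_span_singleton ha
  have hm : 0 < m := by
    rw [← hfr]
    have : Nontrivial A := ⟨⟨w, (hAmem w).2 hw⟩, 0, by
      intro h; exact hw0 (congrArg Subtype.val h)⟩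
    exact Module.finrank_pos
  have hd : d = m + 1 := by omega
  obtain ⟨b, hb⟩ := exists_basis_apply_eq hfr ⟨0, hm⟩
    (w := (⟨w, (hAmem w).2 hw⟩ : A)) (by intro h; exact hw0 (congrArg Subtype.val h))
  set e : Fin m → EuclideanSpace ℝ (Fin d) := fun k => T (b k) with he
  have hei : LinearIndependent ℝ e := by
    have h1 : LinearIndependent ℝ (fun k => ((b k : A) : EuclideanSpace ℝ (Fin d))) :=
      b.linearIndependent.map' A.subtype (Submodule.ker_subtype A)
    exact h1.map' (T : EuclideanSpace ℝ (Fin d) →ₗ[ℝ] EuclideanSpace ℝ (Fin d))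
      (LinearMap.ker_eq_bot.2 hinj)
  have hne : ∀ k, ⟪n, e k⟫ = 0 := fun k => hn _ ((hAmem _).1 (b k).2)
  have hnspan : n ∉ Submodule.span ℝ (Set.range e) := by
    intro h
    have h1 : Submodule.span ℝ (Set.range e) ≤ (Submodule.span ℝ {n})ᗮ := by
      rw [Submodule.span_le]
      rintro _ ⟨k, rfl⟩
      exact Submodule.mem_orthogonal_singleton_iff_inner_right.2 (hne k)
    exact hnn (Submodule.mem_orthogonal_singleton_iff_inner_right.1 (h1 h))
  have hopt := hei.option hnspan
  -- The basis consists of tangent vectors and the normal `n`, which is orthogonal to them; the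
  -- `none` coordinate thus sees only the normal part.
  let B : Module.Basis (Option (Fin m)) ℝ (EuclideanSpace ℝ (Fin d)) :=
    basisOfLinearIndependentOfCardEqFinrank hopt (by simp [hd])
  have hBnone : B none = n := by simp [B]
  have hBsome : ∀ k, B (some k) = e k := fun k => by simp [B]
  have hcoordn : ∀ x, B.repr x none = ⟪n, x⟫ / ⟪n, n⟫ := by
    intro x
    rw [eq_div_iff hnn]
    nth_rewrite 2 [← B.sum_repr x]
    rw [Fintype.sum_option, inner_add_right, inner_sum]
    simp [hBnone, hBsome, inner_smul_right, hne]
  -- The curve is `W t = t ^ m • Y t` with `Y 0 = w`: the linear part has tangential orders `m + k`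
  -- for `k < m`, and the quadratic part, of order `2 * m`, has leading coefficient `D w w / 2`.
  set Y : ℝ → EuclideanSpace ℝ (Fin d) := fun t => ∑ k : Fin m, t ^ (k : ℕ) • (b k : EuclideanSpace ℝ (Fin d)) with hY
  have hYc : Continuous Y := by fun_prop
  have hY0 : Y 0 = w := by
    simp only [hY]
    rw [Finset.sum_eq_single ⟨0, hm⟩]
    · rw [hb]; simp
    · intro k _ hk
      have : (k : ℕ) ≠ 0 := fun h => hk (Fin.ext h)
      simp [this]
    · simp
  set W : ℝ → EuclideanSpace ℝ (Fin d) := fun t => t ^ m • Y t with hW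
  have hWc : Continuous W := by fun_prop
  have hW0 : W 0 = 0 := by simp [hW, hm.ne']
  have hYa : ∀ t, Y t ∈ A := fun t =>
    Submodule.sum_mem _ fun k _ => Submodule.smul_mem _ _ (b k).2
  have hYt : Tendsto Y (𝓝[>] 0) (𝓝 w) := by
    have := (hYc.tendsto 0).mono_left (nhdsWithin_le_nhds (s := Ioi (0 : ℝ)))
    rwa [hY0] at this
  have hWt : Tendsto W (𝓝[>] 0) (𝓝 0) := by
    have := (hWc.tendsto 0).mono_left (nhdsWithin_le_nhds (s := Ioi (0 : ℝ)))
    rwa [hW0] at this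
  have hpos : ∀ᶠ t in 𝓝[>] (0 : ℝ), 0 < t := self_mem_nhdsWithin
  set Rm : ℝ → EuclideanSpace ℝ (Fin d) :=
    fun t => (t ^ (2 * m))⁻¹ • (ψ (z + W t) - ψ z - T (W t)) with hRm
  have hR : Tendsto Rm (𝓝[>] 0) (𝓝 ((2⁻¹ : ℝ) • D w w)) := by
    have h1 := (hψ.taylor_two_isLittleO).comp_tendsto hWt
    have h2 : (fun t => ‖W t‖ ^ 2) =O[𝓝[>] (0 : ℝ)] fun t => t ^ (2 * m) := by
      have h3 : (fun t => ‖Y t‖ ^ 2) =O[𝓝[>] (0 : ℝ)] fun _ => (1 : ℝ) :=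
        (hYt.norm.pow 2).isBigO_one ℝ
      have h4 := (isBigO_refl (fun t : ℝ => t ^ (2 * m)) (𝓝[>] (0 : ℝ))).mul h3
      refine (h4.congr_left fun t => ?_).congr_right fun t => by ring
      simp only [hW, norm_smul, norm_pow, Real.norm_eq_abs]
      rw [mul_pow, ← pow_mul, mul_comm m 2, pow_mul |t|, sq_abs, ← pow_mul]
    have h3 := h1.trans_isBigO h2
    have h4 := h3.tendsto_inv_smul_nhds_zero
    have h5 : Tendsto (fun t => (2⁻¹ : ℝ) • D (Y t) (Y t)) (𝓝[>] 0) (𝓝 ((2⁻¹ : ℝ) • D w w)) := by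
      have hc : Continuous fun y => (2⁻¹ : ℝ) • D y y := by fun_prop
      exact (hc.tendsto w).comp hYt
    have h6 := h4.add h5
    rw [zero_add] at h6
    refine h6.congr' ?_
    filter_upwards [hpos] with t ht
    simp only [Function.comp, hRm]
    have h7 : D (W t) (W t) = t ^ (2 * m) • D (Y t) (Y t) := by
      simp only [hW, map_smul, _root_.smul_apply, smul_smul]
      rw [← pow_add, two_mul]
    have h8 : t ^ (2 * m) ≠ 0 := by positivity
    rw [h7, smul_comm (2⁻¹ : ℝ) (t ^ (2 * m)), smul_sub, smul_smul, inv_mul_cancel₀ h8, one_smul,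
      sub_add_cancel]
  have hcoordW : ∀ t (k : Fin m), B.repr (T (W t)) (some k) = t ^ (m + (k : ℕ)) := by
    intro t k
    have h1 : T (W t) = ∑ j : Fin m, t ^ (m + (j : ℕ)) • B (some j) := by
      simp only [hW, hY, map_smul, map_sum, hBsome, he, Finset.smul_sum, smul_smul, pow_add]
    rw [h1, map_sum, Finsupp.finsetSum_apply, Finset.sum_eq_single k]
    · simp
    · intro j _ hj
      simp [hj]
    · simp
  set α : Option (Fin m) → ℕ := fun o => o.elim (2 * m) fun k => m + k with hα
  set lim : Option (Fin m) → ℝ := fun o => o.elim (⟪n, (2⁻¹ : ℝ) • D w w⟫ / ⟪n, n⟫) fun _ => 1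
    with hlim
  have hlim0 : ∀ k, lim k ≠ 0 := by
    rintro (_ | k)
    · simp only [hlim, Option.elim, inner_smul_right]
      exact div_ne_zero (mul_ne_zero (by norm_num) hQ) hnn
    · simp [hlim]
  have hcoordt : ∀ k, Tendsto (fun t => B.repr (ψ (z + W t) - ψ z) k / t ^ α k) (𝓝[>] 0)
      (𝓝 (lim k)) := by
    rintro (_ | k)
    · have h1 : Tendsto (fun t => ⟪n, Rm t⟫ / ⟪n, n⟫) (𝓝[>] 0) (𝓝 (lim none)) := by
        have hc : Continuous fun y : EuclideanSpace ℝ (Fin d) => ⟪n, y⟫ / ⟪n, n⟫ := by fun_prop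
        exact (hc.tendsto _).comp hR
      refine h1.congr fun t => ?_
      have h2 : ⟪n, T (W t)⟫ = 0 := hn _ ((hAmem _).1 (A.smul_mem _ (hYa t)))
      rw [hcoordn]
      simp only [hRm, hα, Option.elim, inner_smul_right, inner_sub_right, h2]
      ring
    · have hc : Continuous fun y : EuclideanSpace ℝ (Fin d) => B.repr y (some k) :=
        LinearMap.continuous_of_finiteDimensional (B.coord (some k))
      have h1 : Tendsto (fun t => B.repr (Rm t) (some k)) (𝓝[>] 0) (𝓝 _) :=
        (hc.tendsto _).comp hR
      -- Since `k < m`, the remainder of order `2 * m` is negligible against `t ^ (m + k)`.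
      have h2 : Tendsto (fun t : ℝ => t ^ (m - (k : ℕ))) (𝓝[>] 0) (𝓝 0) := by
        have h3 : Continuous fun t : ℝ => t ^ (m - (k : ℕ)) := by fun_prop
        have h4 := (h3.tendsto 0).mono_left (nhdsWithin_le_nhds (s := Ioi (0 : ℝ)))
        have h5 : m - (k : ℕ) ≠ 0 := by have := k.2; omega
        simpa [h5] using h4
      have h3 := (h1.mul h2).add_const 1
      rw [mul_zero, zero_add] at h3
      refine h3.congr' ?_
      filter_upwards [hpos] with t ht
      simp only [hRm, hα, Option.elim, map_smul, map_sub, Finsupp.smul_apply, Finsupp.sub_apply,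
        hcoordW, smul_eq_mul]
      have h4 : t ^ (2 * m) = t ^ (m - (k : ℕ)) * t ^ (m + (k : ℕ)) := by
        rw [← pow_add]; congr 1; have := k.2; omega
      have h5 : t ^ (m - (k : ℕ)) ≠ 0 := by positivity
      have h6 : t ^ (m + (k : ℕ)) ≠ 0 := by positivity
      rw [h4]
      field_simp
      ring
  set c₁ : ℝ := Finset.univ.inf' Finset.univ_nonempty fun k => |lim k| / 2 with hc₁
  set c₂ : ℝ := Finset.univ.sup' Finset.univ_nonempty fun k => |lim k| * 2 with hc₂
  refine ⟨α, B, W, c₁, c₂, ?_, ?_, ?_, ?_, hWt, ?_⟩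
  · rintro (_ | k) (_ | l) h
    · rfl
    · simp only [hα, Option.elim] at h; have := l.2; omega
    · simp only [hα, Option.elim] at h; have := k.2; omega
    · simp only [hα, Option.elim] at h
      congr 1
      exact Fin.ext (by omega)
  · rintro (_ | k)
    · simp only [hα, Option.elim]; omega
    · simp only [hα, Option.elim]; omega
  · rw [hc₁, Finset.lt_inf'_iff]
    exact fun k _ => half_pos (abs_pos.2 (hlim0 k))
  · exact fun t => (hAmem _).1 (A.smul_mem _ (hYa t))
  · rw [eventually_all]
    intro k
    have h1 := (hcoordt k).abs
    have hk := abs_pos.2 (hlim0 k)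
    filter_upwards [h1.eventually (lt_mem_nhds (half_lt_self hk)),
      h1.eventually (gt_mem_nhds (show |lim k| < |lim k| * 2 by linarith)), hpos] with t ht1 ht2 ht
    rw [abs_div, abs_of_pos (by positivity : 0 < t ^ α k)] at ht1 ht2
    rw [lt_div_iff₀ (by positivity)] at ht1
    rw [div_lt_iff₀ (by positivity)] at ht2
    have hle1 : c₁ ≤ |lim k| / 2 := Finset.inf'_le _ (Finset.mem_univ k)
    have hle2 : |lim k| * 2 ≤ c₂ := Finset.le_sup' (fun k => |lim k| * 2) (Finset.mem_univ k)
    constructor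
    · refine le_trans ?_ ht1.le
      gcongr
    · refine ht2.le.trans ?_
      gcongr

end Curve

/-! ### A hypersurface without curved points has flat components. -/

section Flatness

open scoped Topology
open Filter

variable {d : ℕ}

/-- A `C²` chart in which `S` is the part `0 ≤ ⟪b, z⟫ + β` of the hyperplane `⟪a, z⟫ = 0`; the
vector `e` points along the hyperplane into the interior of this part. -/
structure IsHalfSliceChart (S : Set (EuclideanSpace ℝ (Fin d)))
    (φ : OpenPartialHomeomorph (EuclideanSpace ℝ (Fin d)) (EuclideanSpace ℝ (Fin d)))
    (a b e : EuclideanSpace ℝ (Fin d)) (β : ℝ) : Prop where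
  contDiffOn : ContDiffOn ℝ 2 φ φ.source
  contDiffOn_symm : ContDiffOn ℝ 2 φ.symm φ.target
  ne_zero : a ≠ 0
  inner_eq_zero : ⟪a, e⟫ = 0
  inward : (b = 0 ∧ 0 < β) ∨ 0 < ⟪b, e⟫
  mem_iff : ∀ x ∈ φ.source, x ∈ S ↔ ⟪a, φ x⟫ = 0 ∧ 0 ≤ ⟪b, φ x⟫ + β

/-- Interior points take `b = 0` and `β = 1`, so that the inequality is void. Boundary points take
`β = 0` and the component of `b` orthogonal to `a` as inward vector, nonzero by linear independence.
-/
theorem IsC2Hypersurface.exists_isHalfSliceChart {S : Set (EuclideanSpace ℝ (Fin d))}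
    (hS : IsC2Hypersurface S) {p : EuclideanSpace ℝ (Fin d)} (hp : p ∈ S) :
    ∃ φ a b e β, p ∈ φ.source ∧ IsHalfSliceChart S φ a b e β := by
  obtain ⟨φ, hpφ, h1, h2, ⟨a, ha, h3⟩ | ⟨a, b, hab, h3⟩⟩ := hS p hp
  · exact ⟨φ, a, 0, 0, 1, hpφ, h1, h2, ha, by simp, Or.inl ⟨rfl, one_pos⟩,
      fun x hx => by simp [h3 x hx]⟩
  · have ha : a ≠ 0 := by simpa using hab.ne_zero 0
    have haa : ⟪a, a⟫ ≠ 0 := inner_self_ne_zero.2 ha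
    set e := b - (⟪a, b⟫ / ⟪a, a⟫) • a with he
    have hae : ⟪a, e⟫ = 0 := by
      rw [he, inner_sub_right, inner_smul_right, div_mul_cancel₀ _ haa, sub_self]
    have he0 : e ≠ 0 := by
      intro h0
      have := LinearIndependent.pair_iff.1 hab (-(⟪a, b⟫ / ⟪a, a⟫)) 1
        (by rw [← h0, he, neg_smul, one_smul]; abel)
      exact one_ne_zero this.2
    refine ⟨φ, a, b, e, 0, hpφ, h1, h2, ha, hae, Or.inr ?_, fun x hx => by simp [h3 x hx]⟩
    have hbe : ⟪b, e⟫ = ⟪e, e⟫ := by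
      have : b = e + (⟪a, b⟫ / ⟪a, a⟫) • a := by rw [he]; abel
      nth_rewrite 1 [this]
      rw [inner_add_left, inner_smul_left, hae, mul_zero, add_zero]
    rw [hbe]
    exact real_inner_self_pos.2 he0

/-- The image of the hyperplane `⟪a, ·⟫ = 0` under the parametrization `ψ` has nonzero second
fundamental form at `ψ z`. -/
def IsCurvedAt (ψ : EuclideanSpace ℝ (Fin d) → EuclideanSpace ℝ (Fin d))
    (a z : EuclideanSpace ℝ (Fin d)) : Prop :=
  ∃ w n, ⟪a, w⟫ = 0 ∧ (∀ v, ⟪a, v⟫ = 0 → ⟪n, fderiv ℝ ψ z v⟫ = 0) ∧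
    ⟪n, fderiv ℝ (fderiv ℝ ψ) z w w⟫ ≠ 0

theorem OpenPartialHomeomorph.fderiv_comp_fderiv_symm {E : Type*} [NormedAddCommGroup E]
    [NormedSpace ℝ E] (φ : OpenPartialHomeomorph E E) {z : E} (hz : z ∈ φ.target)
    (hφ : DifferentiableAt ℝ φ (φ.symm z)) (hψ : DifferentiableAt ℝ φ.symm z) (v : E) :
    fderiv ℝ φ (φ.symm z) (fderiv ℝ φ.symm z v) = v := by
  have h1 := hφ.hasFDerivAt.comp z hψ.hasFDerivAt
  have h2 : HasFDerivAt (φ ∘ φ.symm) (ContinuousLinearMap.id ℝ E) z := by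
    refine (hasFDerivAt_id z).congr_of_eventuallyEq ?_
    filter_upwards [φ.open_target.mem_nhds hz] with y hy
    exact φ.right_inv hy
  exact congrArg (fun L : E →L[ℝ] E => L v) (h1.unique h2)

namespace IsHalfSliceChart

variable {S : Set (EuclideanSpace ℝ (Fin d))}
  {φ : OpenPartialHomeomorph (EuclideanSpace ℝ (Fin d)) (EuclideanSpace ℝ (Fin d))}
  {a b e : EuclideanSpace ℝ (Fin d)} {β : ℝ}

theorem contDiffAt (h : IsHalfSliceChart S φ a b e β) {x} (hx : x ∈ φ.source) :
    ContDiffAt ℝ 2 φ x := h.contDiffOn.contDiffAt (φ.open_source.mem_nhds hx)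

theorem contDiffAt_symm (h : IsHalfSliceChart S φ a b e β) {z} (hz : z ∈ φ.target) :
    ContDiffAt ℝ 2 φ.symm z := h.contDiffOn_symm.contDiffAt (φ.open_target.mem_nhds hz)

theorem fderiv_fderiv_symm (h : IsHalfSliceChart S φ a b e β) {z} (hz : z ∈ φ.target) (v) :
    fderiv ℝ φ (φ.symm z) (fderiv ℝ φ.symm z v) = v :=
  φ.fderiv_comp_fderiv_symm hz ((h.contDiffAt (φ.map_target hz)).differentiableAt two_ne_zero)
    ((h.contDiffAt_symm hz).differentiableAt two_ne_zero) v

theorem fderiv_symm_fderiv (h : IsHalfSliceChart S φ a b e β) {z} (hz : z ∈ φ.target) (v) :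
    fderiv ℝ φ.symm z (fderiv ℝ φ (φ.symm z) v) = v := by
  have h1 := φ.symm.fderiv_comp_fderiv_symm (z := φ.symm z) (φ.map_target hz)
    (by
      rw [φ.symm_symm, φ.right_inv hz]
      exact (h.contDiffAt_symm hz).differentiableAt two_ne_zero)
    ((h.contDiffAt (φ.map_target hz)).differentiableAt two_ne_zero) v
  rwa [φ.symm_symm, φ.right_inv hz] at h1

/-- The vector `(Dφ)ᵀ a` is normal to the image of the hyperplane `⟪a, ·⟫ = 0`. -/
theorem inner_adjoint_fderiv_symm (h : IsHalfSliceChart S φ a b e β) {z} (hz : z ∈ φ.target) (v) :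
    ⟪(fderiv ℝ φ (φ.symm z)).adjoint a, fderiv ℝ φ.symm z v⟫ = ⟪a, v⟫ := by
  rw [ContinuousLinearMap.adjoint_inner_left, h.fderiv_fderiv_symm hz]

/-- Flatness kills the quadratic form in the normal direction `(Dφ)ᵀ a`; polarization kills the
symmetric bilinear form. -/
theorem inner_fderiv_snd_eq_zero (h : IsHalfSliceChart S φ a b e β) {z} (hz : z ∈ φ.target)
    (hflat : ¬ IsCurvedAt φ.symm a z) {v w : EuclideanSpace ℝ (Fin d)} (hv : ⟪a, v⟫ = 0)
    (hw : ⟪a, w⟫ = 0) :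
    ⟪a, fderiv ℝ φ (φ.symm z) (fderiv ℝ (fderiv ℝ φ.symm) z v w)⟫ = 0 := by
  rw [← ContinuousLinearMap.adjoint_inner_left]
  set n := (fderiv ℝ φ (φ.symm z)).adjoint a with hn
  set D := fderiv ℝ (fderiv ℝ φ.symm) z with hD
  have hsymm : D v w = D w v := (h.contDiffAt_symm hz).isSymmSndFDerivAt (by simp) v w
  have hq : ∀ w, ⟪a, w⟫ = 0 → ⟪n, D w w⟫ = 0 := by
    intro w hw
    by_contra hne
    exact hflat ⟨w, n, hw, fun v hv => by rw [hn, h.inner_adjoint_fderiv_symm hz, hv], hne⟩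
  have h1 := hq (v + w) (by rw [inner_add_right, hv, hw, add_zero])
  simp only [map_add, _root_.add_apply, inner_add_right, hq v hv, hq w hw,
    ← hsymm] at h1
  linarith

/-- Along a segment on which the second fundamental form vanishes, the normal is constant. -/
theorem inner_symm_eq_of_flat_segment (h : IsHalfSliceChart S φ a b e β)
    {z₁ z n : EuclideanSpace ℝ (Fin d)} (hz : ⟪a, z - z₁⟫ = 0)
    (hseg : ∀ t ∈ Icc (0 : ℝ) 1, z₁ + t • (z - z₁) ∈ φ.target ∧
      ¬ IsCurvedAt φ.symm a (z₁ + t • (z - z₁)))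
    (hn : ∀ v, ⟪a, v⟫ = 0 → ⟪n, fderiv ℝ φ.symm z₁ v⟫ = 0) :
    ⟪n, φ.symm z⟫ = ⟪n, φ.symm z₁⟫ := by
  set A := (Submodule.span ℝ {a})ᗮ with hA
  have hAmem : ∀ v, v ∈ A ↔ ⟪a, v⟫ = 0 := fun v =>
    Submodule.mem_orthogonal_singleton_iff_inner_right
  set v := z - z₁ with hv
  set Z : ℝ → EuclideanSpace ℝ (Fin d) := fun t => z₁ + t • v with hZ
  have hZc : Continuous Z := by fun_prop
  have hZd : ∀ t, HasDerivAt Z v t := fun t => by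
    have := ((hasDerivAt_id t).smul_const v).const_add z₁
    simpa [hZ] using this
  have hZt : ∀ t ∈ Icc (0 : ℝ) 1, Z t ∈ φ.target := fun t ht => (hseg t ht).1
  have hψ1 : ContDiffOn ℝ 1 (fderiv ℝ φ.symm) φ.target :=
    h.contDiffOn_symm.fderiv_of_isOpen φ.open_target (by norm_num)
  have hψ2 : ContinuousOn (fderiv ℝ (fderiv ℝ φ.symm)) φ.target :=
    hψ1.continuousOn_fderiv_of_isOpen φ.open_target le_rfl
  have hφ1 : ContinuousOn (fderiv ℝ φ) φ.source :=
    h.contDiffOn.continuousOn_fderiv_of_isOpen φ.open_source (by norm_num)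
  have hcont : ContinuousOn (fun t => ‖fderiv ℝ φ (φ.symm (Z t))‖ *
      ‖fderiv ℝ (fderiv ℝ φ.symm) (Z t) v‖) (Icc 0 1) := by
    apply ContinuousOn.mul
    · exact ((hφ1.comp (φ.continuousOn_symm.comp hZc.continuousOn hZt)
        fun t ht => φ.map_target (hZt t ht))).norm
    · exact ((hψ2.comp hZc.continuousOn hZt).clm_apply continuousOn_const).norm
  obtain ⟨C, hC⟩ := isCompact_Icc.exists_bound_of_continuousOn hcont
  set Φ : (EuclideanSpace ℝ (Fin d) →L[ℝ] EuclideanSpace ℝ (Fin d)) → (A →L[ℝ] ℝ) :=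
    fun L => (innerSL ℝ n).comp (L.comp A.subtypeL) with hΦdef
  have hΦ : ∀ L (w : A), Φ L w = ⟪n, L w⟫ := fun L w => rfl
  -- `G t` measures the failure of `n` to be normal at time `t`. It vanishes at `0`, and flatness
  -- yields a linear differential inequality, so Grönwall makes it vanish throughout.
  set G : ℝ → (A →L[ℝ] ℝ) := fun t => Φ (fderiv ℝ φ.symm (Z t)) with hG
  have hGd : ∀ t ∈ Icc (0 : ℝ) 1,
      HasDerivAt G (Φ (fderiv ℝ (fderiv ℝ φ.symm) (Z t) v)) t := by
    intro t ht
    have h1 : HasFDerivAt (fderiv ℝ φ.symm) (fderiv ℝ (fderiv ℝ φ.symm) (Z t)) (Z t) :=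
      ((hψ1.contDiffAt (φ.open_target.mem_nhds (hZt t ht))).differentiableAt
        one_ne_zero).hasFDerivAt
    have h2 : HasDerivAt (fun t => fderiv ℝ φ.symm (Z t))
        (fderiv ℝ (fderiv ℝ φ.symm) (Z t) v) t := h1.comp_hasDerivAt t (hZd t)
    have h3 := (hasDerivAt_const t (innerSL ℝ n)).clm_comp
      (h2.clm_comp (hasDerivAt_const t A.subtypeL))
    simpa [hG, hΦdef] using h3
  have hGz : ∀ t ∈ Icc (0 : ℝ) 1, G t = 0 := by
    refine eq_zero_of_abs_deriv_le_mul_abs_self_of_eq_zero_right (K := C)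
      (f' := fun t => Φ (fderiv ℝ (fderiv ℝ φ.symm) (Z t) v))
      (fun t ht => (hGd t ht).continuousAt.continuousWithinAt)
      (fun t ht => (hGd t (Ico_subset_Icc_self ht)).hasDerivWithinAt) ?_ ?_
    · ext w
      simp only [hG, hΦ, hZ, zero_smul, add_zero]
      exact hn _ ((hAmem _).1 w.2)
    · intro t ht'
      have ht := Ico_subset_Icc_self ht'
      have hC0 : 0 ≤ C := (norm_nonneg _).trans (hC t ht)
      refine ContinuousLinearMap.opNorm_le_bound _ (by positivity) fun w => ?_
      -- By flatness the second derivative is again tangent, so it is the image of some `w'` in the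
      -- hyperplane and `G'` is expressed through `G` itself.
      set w' := fderiv ℝ φ (φ.symm (Z t)) (fderiv ℝ (fderiv ℝ φ.symm) (Z t) v w) with hw'
      have hw'A : w' ∈ A := (hAmem _).2
        (h.inner_fderiv_snd_eq_zero (hZt t ht) (hseg t ht).2 hz ((hAmem _).1 w.2))
      have h1 : Φ (fderiv ℝ (fderiv ℝ φ.symm) (Z t) v) w = G t ⟨w', hw'A⟩ := by
        simp only [hG, hΦ]
        rw [hw', h.fderiv_symm_fderiv (hZt t ht)]
      rw [h1]
      refine ((G t).le_opNorm _).trans ?_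
      have h2 : ‖w'‖ ≤ C * ‖w‖ := by
        have h3 := hC t ht
        rw [Real.norm_of_nonneg (by positivity)] at h3
        calc ‖w'‖ ≤ ‖fderiv ℝ φ (φ.symm (Z t))‖ * (‖fderiv ℝ (fderiv ℝ φ.symm) (Z t) v‖ * ‖w‖) :=
              (ContinuousLinearMap.le_opNorm _ _).trans
                (mul_le_mul_of_nonneg_left (ContinuousLinearMap.le_opNorm _ _) (norm_nonneg _))
          _ = _ := (mul_assoc _ _ _).symm
          _ ≤ C * ‖w‖ := mul_le_mul_of_nonneg_right h3 (norm_nonneg _)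
      calc ‖G t‖ * ‖(⟨w', hw'A⟩ : A)‖ ≤ ‖G t‖ * (C * ‖w‖) :=
            mul_le_mul_of_nonneg_left h2 (norm_nonneg (G t))
        _ = _ := by ring
  have hfd : ∀ t ∈ Icc (0 : ℝ) 1, HasDerivAt (fun t => ⟪n, φ.symm (Z t)⟫ - ⟪n, φ.symm z₁⟫) 0 t := by
    intro t ht
    have h1 := (((h.contDiffAt_symm (hZt t ht)).differentiableAt
      two_ne_zero).hasFDerivAt).comp_hasDerivAt t (hZd t)
    have h2 := ((innerSL ℝ n).hasFDerivAt.comp_hasDerivAt t h1).sub_const ⟪n, φ.symm z₁⟫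
    have h3 : (innerSL ℝ n) (fderiv ℝ φ.symm (Z t) v) = 0 := by
      have := congrArg (fun L : A →L[ℝ] ℝ => L ⟨v, (hAmem v).2 hz⟩) (hGz t ht)
      simpa [hG, hΦ] using this
    rw [h3] at h2
    exact h2
  have hfin := eq_zero_of_abs_deriv_le_mul_abs_self_of_eq_zero_right (K := 0) (f' := fun _ => 0)
    (fun t ht => (hfd t ht).continuousAt.continuousWithinAt)
    (fun t ht => (hfd t (Ico_subset_Icc_self ht)).hasDerivWithinAt) (by simp [hZ])
    (fun t _ => by simp) 1 (right_mem_Icc.2 zero_le_one)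
  have hZ1 : Z 1 = z := by simp [hZ, hv]
  rw [hZ1] at hfin
  linarith

theorem inner_add_smul_pos (h : IsHalfSliceChart S φ a b e β) {z : EuclideanSpace ℝ (Fin d)}
    (hz : 0 ≤ ⟪b, z⟫ + β) {s : ℝ} (hs : 0 < s) : 0 < ⟪b, z + s • e⟫ + β := by
  rw [inner_add_right, inner_smul_right]
  rcases h.inward with ⟨rfl, hβ⟩ | hbe
  · simpa using hβ
  · have := mul_pos hs hbe
    linarith

/-- If the second fundamental form vanishes in the interior, the surface is locally contained in a
hyperplane. -/
theorem exists_eventually_mem_hyperplane (h : IsHalfSliceChart S φ a b e β)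
    {p : EuclideanSpace ℝ (Fin d)} (hp : p ∈ φ.source) (hpS : p ∈ S)
    (hflat : ∀ z ∈ φ.target, ⟪a, z⟫ = 0 → 0 < ⟪b, z⟫ + β → ¬ IsCurvedAt φ.symm a z) :
    ∃ n t, n ≠ 0 ∧ ∀ᶠ x in 𝓝 p, x ∈ S → ⟪n, x⟫ = t := by
  obtain ⟨ε, hε, hε'⟩ := Metric.isOpen_iff.1 φ.open_target _ (φ.map_source hp)
  have hsmall : ∀ z ∈ Metric.ball (φ p) ε, ∀ᶠ s in 𝓝[>] (0 : ℝ), z + s • e ∈ Metric.ball (φ p) ε := by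
    intro z hz
    have hc : Continuous fun s : ℝ => z + s • e := by fun_prop
    have h1 : Tendsto (fun s : ℝ => z + s • e) (𝓝[>] 0) (𝓝 z) := by
      simpa using (hc.tendsto 0).mono_left (nhdsWithin_le_nhds (s := Ioi (0 : ℝ)))
    exact h1.eventually_mem (Metric.isOpen_ball.mem_nhds hz)
  have hpos : ∀ᶠ s in 𝓝[>] (0 : ℝ), 0 < s := self_mem_nhdsWithin
  have hpz := (h.mem_iff p hp).1 hpS
  -- Moving the base point inward keeps whole segments in the interior, where flatness is assumed,
  -- even when `p` lies on the boundary.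
  obtain ⟨s₁, hs₁, hs₁0⟩ := ((hsmall _ (Metric.mem_ball_self hε)).and hpos).exists
  set z₁ := φ p + s₁ • e with hz₁
  have hz₁a : ⟪a, z₁⟫ = 0 := by
    rw [hz₁, inner_add_right, inner_smul_right, h.inner_eq_zero, hpz.1]; simp
  have hz₁b : 0 < ⟪b, z₁⟫ + β := h.inner_add_smul_pos hpz.2 hs₁0
  set n := (fderiv ℝ φ (φ.symm z₁)).adjoint a with hn
  have hinner : ∀ z ∈ Metric.ball (φ p) ε, ⟪a, z⟫ = 0 → 0 < ⟪b, z⟫ + β →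
      ⟪n, φ.symm z⟫ = ⟪n, φ.symm z₁⟫ := by
    intro z hz hza hzb
    have hza' : ⟪a, z - z₁⟫ = 0 := by rw [inner_sub_right, hza, hz₁a, sub_zero]
    refine h.inner_symm_eq_of_flat_segment hza' (fun t ht => ?_)
      (fun v hv => by rw [hn, h.inner_adjoint_fderiv_symm (hε' hs₁), hv])
    have hmem : z₁ + t • (z - z₁) ∈ Metric.ball (φ p) ε :=
      (convex_ball (φ p) ε).add_smul_sub_mem hs₁ hz ht
    refine ⟨hε' hmem, hflat _ (hε' hmem) ?_ ?_⟩
    · rw [inner_add_right, inner_smul_right, hz₁a, hza']; simp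
    · rw [inner_add_right, inner_smul_right, inner_sub_right]
      rcases eq_or_lt_of_le ht.1 with h0 | h0
      · rw [← h0]; linarith
      · nlinarith [ht.2, mul_pos h0 hzb, mul_nonneg (sub_nonneg.2 ht.2) hz₁b.le]
  refine ⟨n, ⟪n, φ.symm z₁⟫, ?_, ?_⟩
  · intro h0
    have h1 := h.inner_adjoint_fderiv_symm (hε' hs₁) a
    rw [← hn, h0, inner_zero_left] at h1
    exact inner_self_ne_zero.2 h.ne_zero h1.symm
  · filter_upwards [φ.open_source.mem_nhds hp,
      (φ.continuousAt hp).eventually_mem (Metric.ball_mem_nhds _ hε)] with x hx hxε hxS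
    have hxz := (h.mem_iff x hx).1 hxS
    -- Boundary points are reached as limits of interior ones along `e`.
    have hlim : Tendsto (fun s : ℝ => ⟪n, φ.symm (φ x + s • e)⟫) (𝓝[>] 0) (𝓝 ⟪n, x⟫) := by
      have hc : Continuous fun s : ℝ => φ x + s • e := by fun_prop
      have h1 : Tendsto (fun s : ℝ => φ x + s • e) (𝓝[>] 0) (𝓝 (φ x)) := by
        simpa using (hc.tendsto 0).mono_left (nhdsWithin_le_nhds (s := Ioi (0 : ℝ)))
      have h2 := (φ.continuousAt_symm (φ.map_source hx)).tendsto.comp h1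
      rw [φ.left_inv hx] at h2
      exact tendsto_const_nhds.inner h2
    refine tendsto_nhds_unique hlim (tendsto_const_nhds.congr' ?_)
    filter_upwards [hsmall _ hxε, hpos] with s hs hs0
    refine (hinner _ hs ?_ (h.inner_add_smul_pos hxz.2 hs0)).symm
    rw [inner_add_right, inner_smul_right, h.inner_eq_zero, hxz.1]; simp

/-- The germ of the surface at a point determines a hyperplane containing it. -/
theorem eq_smul_of_eventually_mem_hyperplane (h : IsHalfSliceChart S φ a b e β)
    {p : EuclideanSpace ℝ (Fin d)} (hp : p ∈ φ.source) (hpS : p ∈ S)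
    {n : EuclideanSpace ℝ (Fin d)} {t : ℝ} (hn : ∀ᶠ x in 𝓝 p, x ∈ S → ⟪n, x⟫ = t) :
    ∃ μ : ℝ, n = μ • (fderiv ℝ φ p).adjoint a := by
  have hpz := (h.mem_iff p hp).1 hpS
  have hpt := φ.map_source hp
  set T := fderiv ℝ φ.symm (φ p) with hT
  have hTd : HasFDerivAt φ.symm T (φ p) :=
    ((h.contDiffAt_symm hpt).differentiableAt two_ne_zero).hasFDerivAt
  -- In a direction that does not leave the half-hyperplane, `⟪n, ·⟫` is constant along a curve in
  -- `S`, so a one-sided derivative suffices.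
  have hin : ∀ w, ⟪a, w⟫ = 0 → 0 ≤ ⟪b, w⟫ → ⟪n, T w⟫ = 0 := by
    intro w haw hbw
    have hline : HasDerivAt (fun s : ℝ => φ p + s • w) w 0 := by
      simpa using ((hasDerivAt_id (0 : ℝ)).smul_const w).const_add (φ p)
    have hc : ContinuousAt (fun s : ℝ => φ p + s • w) 0 := hline.continuousAt
    have h1 : HasDerivAt (fun s : ℝ => φ.symm (φ p + s • w)) (T w) 0 :=
      HasFDerivAt.comp_hasDerivAt (0 : ℝ) (by simpa using hTd) hline
    have h2 : HasDerivAt (fun s : ℝ => ⟪n, φ.symm (φ p + s • w)⟫) ⟪n, T w⟫ 0 :=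
      (innerSL ℝ n).hasFDerivAt.comp_hasDerivAt 0 h1
    have h3 : (fun s : ℝ => ⟪n, φ.symm (φ p + s • w)⟫) =ᶠ[𝓝[≥] 0] fun _ => t := by
      have h4 : ∀ᶠ s in 𝓝 (0 : ℝ), φ p + s • w ∈ φ.target :=
        hc.eventually_mem (φ.open_target.mem_nhds (by simpa using hpt))
      have h5 : Tendsto (fun s : ℝ => φ.symm (φ p + s • w)) (𝓝 0) (𝓝 p) := by
        have := h1.continuousAt.tendsto
        simpa [φ.left_inv hp] using this
      filter_upwards [h4.filter_mono nhdsWithin_le_nhds,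
        (h5.eventually hn).filter_mono nhdsWithin_le_nhds, self_mem_nhdsWithin] with s hs1 hs2 hs3
      apply hs2
      rw [h.mem_iff _ (φ.map_target hs1), φ.right_inv hs1]
      simp only [inner_add_right, inner_smul_right, haw, hpz.1, mul_zero, add_zero, true_and]
      have : 0 ≤ s * ⟪b, w⟫ := mul_nonneg hs3 hbw
      linarith [hpz.2]
    have h6 : HasDerivWithinAt (fun s : ℝ => ⟪n, φ.symm (φ p + s • w)⟫) 0 (Ici 0) 0 :=
      (hasDerivWithinAt_const (0 : ℝ) (Ici 0) t).congr_of_eventuallyEq h3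
        (h3.self_of_nhdsWithin self_mem_Ici)
    exact (uniqueDiffOn_Ici (0 : ℝ) 0 self_mem_Ici).eq_deriv _ h2.hasDerivWithinAt h6
  have hall : ∀ w, ⟪a, w⟫ = 0 → ⟪n, T w⟫ = 0 := by
    intro w haw
    rcases h.inward with ⟨rfl, -⟩ | hbe
    · exact hin w haw (by simp)
    · set C := |⟪b, w⟫| / ⟪b, e⟫ with hC
      have h1 : ⟪n, T (w + C • e)⟫ = 0 := by
        apply hin
        · rw [inner_add_right, inner_smul_right, haw, h.inner_eq_zero]; simp
        · rw [inner_add_right, inner_smul_right, hC, div_mul_cancel₀ _ hbe.ne']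
          linarith [neg_abs_le ⟪b, w⟫]
      have h2 := hin e h.inner_eq_zero hbe.le
      rwa [map_add, map_smul, inner_add_right, inner_smul_right, h2, mul_zero, add_zero] at h1
  have hspan : T.adjoint n ∈ Submodule.span ℝ {a} := by
    rw [← Submodule.orthogonal_orthogonal (Submodule.span ℝ {a}), Submodule.mem_orthogonal']
    intro w hw
    rw [ContinuousLinearMap.adjoint_inner_left]
    exact hall w (Submodule.mem_orthogonal_singleton_iff_inner_right.1 hw)
  obtain ⟨μ, hμ⟩ := Submodule.mem_span_singleton.1 hspan
  refine ⟨μ, ext_inner_right ℝ fun v => ?_⟩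
  rw [← map_smul, hμ, ContinuousLinearMap.adjoint_inner_left,
    ContinuousLinearMap.adjoint_inner_left]
  have h1 := h.fderiv_symm_fderiv hpt v
  rw [φ.left_inv hp] at h1
  rw [hT, h1]

end IsHalfSliceChart

/-- A hypersurface with a component not contained in a hyperplane is curved somewhere. -/
theorem IsC2Hypersurface.exists_isCurvedAt {S : Set (EuclideanSpace ℝ (Fin d))}
    (hS : IsC2Hypersurface S) (hS_flat : ∃ p ∈ S, ¬ LiesInHyperplane (connectedComponentIn S p)) :
    ∃ φ a b e β, IsHalfSliceChart S φ a b e β ∧ ∃ z ∈ φ.target, ⟪a, z⟫ = 0 ∧ 0 < ⟪b, z⟫ + β ∧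
      IsCurvedAt φ.symm a z := by
  by_contra hcon
  push Not at hcon
  obtain ⟨p, hp, hnot⟩ := hS_flat
  have hloc : ∀ x ∈ S, ∃ n t, n ≠ 0 ∧ ∀ᶠ y in 𝓝 x, y ∈ S → ⟪n, y⟫ = t := by
    intro x hx
    obtain ⟨φ, a, b, e, β, hxφ, hφ⟩ := hS.exists_isHalfSliceChart hx
    exact hφ.exists_eventually_mem_hyperplane hxφ hx (hcon φ a b e β hφ)
  have huniq : ∀ x ∈ S, ∀ n t n' t', n ≠ 0 → (∀ᶠ y in 𝓝 x, y ∈ S → ⟪n, y⟫ = t) →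
      (∀ᶠ y in 𝓝 x, y ∈ S → ⟪n', y⟫ = t') → ∃ l : ℝ, n' = l • n ∧ t' = l * t := by
    intro x hx n t n' t' hn h1 h2
    obtain ⟨φ, a, b, e, β, hxφ, hφ⟩ := hS.exists_isHalfSliceChart hx
    obtain ⟨μ, hμ⟩ := hφ.eq_smul_of_eventually_mem_hyperplane hxφ hx h1
    obtain ⟨μ', hμ'⟩ := hφ.eq_smul_of_eventually_mem_hyperplane hxφ hx h2
    have hμ0 : μ ≠ 0 := by rintro rfl; simp at hμ; exact hn hμ
    have h3 : n' = (μ' / μ) • n := by rw [hμ, hμ', smul_smul, div_mul_cancel₀ _ hμ0]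
    refine ⟨μ' / μ, h3, ?_⟩
    rw [← h1.self_of_nhds hx, ← h2.self_of_nhds hx, h3, inner_smul_left]
    simp
  obtain ⟨n, t, hn, hpn⟩ := hloc p hp
  -- `Ω` collects the points whose germ lies in the hyperplane of `p`, and `Ω'` those whose germ
  -- lies in a hyperplane with non-proportional data. Both are open, they cover the component, and
  -- by `huniq` they do not meet on `S`.
  set Ω : Set (EuclideanSpace ℝ (Fin d)) := {x | ∀ᶠ y in 𝓝 x, y ∈ S → ⟪n, y⟫ = t} with hΩ
  set Ω' : Set (EuclideanSpace ℝ (Fin d)) := ⋃ nt : {nt : EuclideanSpace ℝ (Fin d) × ℝ //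
    ¬ ∃ l : ℝ, nt.1 = l • n ∧ nt.2 = l * t}, {x | ∀ᶠ y in 𝓝 x, y ∈ S → ⟪nt.1.1, y⟫ = nt.1.2}
    with hΩ'
  have hopen : IsOpen Ω := isOpen_setOfPred_eventually_nhds
  have hopen' : IsOpen Ω' := isOpen_iUnion fun _ => isOpen_setOfPred_eventually_nhds
  have hCS := connectedComponentIn_subset S p
  have hcover : connectedComponentIn S p ⊆ Ω ∪ Ω' := by
    intro x hx
    obtain ⟨n', t', hn', hx'⟩ := hloc x (hCS hx)
    by_cases hl : ∃ l : ℝ, n' = l • n ∧ t' = l * t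
    · left
      obtain ⟨l, rfl, rfl⟩ := hl
      have hl0 : l ≠ 0 := by rintro rfl; simp at hn'
      refine hx'.mono fun y hy hyS => ?_
      have := hy hyS
      rw [inner_smul_left] at this
      exact mul_left_cancel₀ hl0 this
    · exact Or.inr (mem_iUnion.2 ⟨⟨(n', t'), hl⟩, hx'⟩)
  have hsub : ∀ x ∈ connectedComponentIn S p, x ∈ Ω := by
    intro x hx
    rcases hcover hx with h | h
    · exact h
    · obtain ⟨y, hyC, hyΩ, hyΩ'⟩ := isPreconnected_connectedComponentIn Ω Ω' hopen hopen' hcover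
        ⟨p, mem_connectedComponentIn hp, hpn⟩ ⟨x, hx, h⟩
      obtain ⟨⟨⟨n', t'⟩, hnt⟩, hy'⟩ := mem_iUnion.1 hyΩ'
      exact absurd (huniq y (hCS hyC) n t n' t' hn hyΩ hy') hnt
  exact hnot ⟨n, t, hn, fun x hx => (hsub x hx).self_of_nhds (hCS hx)⟩

end Flatness

/-! ### Conclusion. -/

theorem proposition3p1 {d : ℕ} (S : Set (EuclideanSpace ℝ (Fin d))) (hS : IsC2Hypersurface S)
    (hS_flat : ∃ p ∈ S, ¬ LiesInHyperplane (connectedComponentIn S p)) :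
    ∃ c : ℝ, 0 < c ∧ ∀ R : ℝ, 1 ≤ R →
      ∃ (f : EuclideanSpace ℝ (Fin d) → ℂ) (h : 𝓢(EuclideanSpace ℝ (Fin d), ℂ)),
        MemLp f 2 (surfaceMeasure S) ∧ eLpNorm f 2 (surfaceMeasure S) ≠ 0 ∧ h ≠ 0 ∧
        tsupport (𝓕 (h : EuclideanSpace ℝ (Fin d) → ℂ)) ⊆ Metric.ball 0 R ∧
        (∀ x, Integrable (fun y => h (x - y) * f y) (surfaceMeasure S)) ∧
        MemLp (convMeasure (surfaceMeasure S) h f) 2 volume ∧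
        ∀ ν : EuclideanSpace ℝ (Fin d), ‖ν‖ = 1 →
          ENNReal.ofReal (c * Real.log R) * eLpNorm f 2 (surfaceMeasure S) ^ 2 * mixedNormSq ν h
            ≤ eLpNorm (convMeasure (surfaceMeasure S) h f) 2 volume ^ 2 := by
  obtain ⟨φ, a, b, e, β, hφ, z, hz, hza, hzb, w, n, hw, hn, hQ⟩ := hS.exists_isCurvedAt hS_flat
  have hd : 1 ≤ d := by
    by_contra hd0
    obtain rfl : d = 0 := by omega
    exact hφ.ne_zero (Subsingleton.elim _ _)
  have hp := φ.map_target hz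
  -- The curved point is interior, so nearby the boundary inequality is automatic and the chart is
  -- an ordinary slice chart.
  have hslice : ∀ᶠ x in nhds (φ.symm z), x ∈ S ↔ ⟪a, φ x⟫ = 0 := by
    have hpos : ∀ᶠ x in nhds (φ.symm z), 0 < ⟪b, φ x⟫ + β := by
      have h1 : ContinuousAt (fun x => ⟪b, φ x⟫ + β) (φ.symm z) :=
        (continuousAt_const.inner (φ.continuousAt hp)).add continuousAt_const
      exact h1.eventually_const_lt (by simpa only [φ.right_inv hz] using hzb)
    filter_upwards [φ.open_source.mem_nhds hp, hpos] with x hx hxb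
    rw [hφ.mem_iff x hx, and_iff_left hxb.le]
  have hψ := hφ.contDiffAt_symm hz
  obtain ⟨b₁, b₂, r₀, hb₁, hb₂, hr₀, hreg⟩ := exists_surfaceMeasure_closedBall_bounds hp
    ((hφ.contDiffAt hp).of_le one_le_two)
    (by rw [φ.right_inv hz]; exact hψ.of_le one_le_two) hφ.ne_zero hslice
  have hinj : Function.Injective (fderiv ℝ φ.symm z) :=
    Function.LeftInverse.injective (g := fderiv ℝ φ (φ.symm z)) fun v => hφ.fderiv_fderiv_symm hz v
  obtain ⟨α, B, W, c₁, c₂, hα, hα1, hc₁, hWa, hWt, hcoord⟩ :=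
    exists_curve_of_second_fundamental_form_ne_zero hψ hinj hφ.ne_zero hw hn hQ
  have hzW : Filter.Tendsto (fun t => z + W t) (nhdsWithin 0 (Ioi 0)) (nhds z) := by
    simpa using hWt.const_add z
  have hγt := (φ.continuousAt_symm hz).tendsto.comp hzW
  have hev : ∀ᶠ t in nhdsWithin (0 : ℝ) (Ioi 0), φ.symm (z + W t) ∈ S ∧
      φ.symm (z + W t) ∈ Metric.ball (φ.symm z) r₀ := by
    filter_upwards [hzW.eventually_mem (φ.open_target.mem_nhds hz), hγt.eventually hslice,
      hγt.eventually_mem (Metric.ball_mem_nhds _ hr₀)] with t ht1 ht2 ht3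
    refine ⟨ht2.2 ?_, ht3⟩
    rw [Function.comp, φ.right_inv ht1, inner_add_right, hza, hWa, add_zero]
  obtain ⟨t₀, ht₀, hsub⟩ := mem_nhdsGT_iff_exists_Ioc_subset.1 (hev.and hcoord)
  rw [mem_Ioi] at ht₀
  -- Rescaling the parameter moves the estimates to `(0, 1]`; the lower constant loses at most `s₀ ^
  -- A`, with `A` the largest exponent.
  set s₀ : ℝ := min t₀ 1 with hs₀
  have hs₀0 : 0 < s₀ := lt_min ht₀ one_pos
  have hs₀1 : s₀ ≤ 1 := min_le_right _ _
  have hmem : ∀ t ∈ Ioc (0 : ℝ) 1, s₀ * t ∈ Ioc 0 t₀ := fun t ht =>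
    ⟨mul_pos hs₀0 ht.1, (mul_le_of_le_one_right hs₀0.le ht.2).trans (min_le_left _ _)⟩
  set A : ℕ := Finset.univ.sup' Finset.univ_nonempty α with hA
  refine exists_log_loss_of_curve hd hα hα1 B (p := φ.symm z)
    (γ := fun t => φ.symm (z + W (s₀ * t))) (c₁ := c₁ * s₀ ^ A) (c₂ := |c₂|) (b₁ := b₁) (b₂ := b₂)
    (r₀ := r₀) (by positivity) hb₁ hb₂ hr₀ (fun t ht k => ?_) (fun t ht k => ?_)
    (fun t ht r hr => ?_) (fun t ht r hr => ?_)
  · refine le_trans ?_ ((hsub (hmem t ht)).2 k).1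
    have ht0 := ht.1
    rw [mul_pow, mul_assoc]
    gcongr ?_ * (?_ * ?_)
    exact pow_le_pow_of_le_one hs₀0.le hs₀1 (Finset.le_sup' α (Finset.mem_univ k))
  · refine ((hsub (hmem t ht)).2 k).2.trans ?_
    have ht0 := ht.1
    refine mul_le_mul (le_abs_self _) ?_ (by positivity) (abs_nonneg _)
    exact pow_le_pow_left₀ (by positivity) (mul_le_of_le_one_left ht0.le hs₀1) _
  · obtain ⟨h1, h2⟩ := (hsub (hmem t ht)).1
    exact (hreg _ h1 h2 r hr).1
  · obtain ⟨h1, h2⟩ := (hsub (hmem t ht)).1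
    exact (hreg _ h1 h2 r hr).2
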